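/- **Theorem 3.1 (Existence).** Let $L>0$ and let $\Phi:\mathbb R\to\mathbb R$ be continuous on $\mathbb R$ and $C^1$ on $\mathbb R\setminus\{1,-1\}$, constant on $(-\infty,-1]$ and constant on $[1,\infty)$, convex on $[-1,1]$, (weakly) decreasing on $[-1,0]$ and (weakly) increasing on $[0,1]$, and such that the one-sided limits $\lim_{s\to1^-}\Phi'(s)$ and $\lim_{s\to-1^+}\Phi'(s)$ exist and are finite (so $\Phi'$ may jump at $\pm1$). Put $\Phi'(\pm1):=0$. Let $u_0\in H^1(0,L)$ and $u_1\in L^2(0,L)$. Then the Neumann problem $$u_{tt}=u_{xx}-\Phi'(u)\ \ (t>0,\ 0<x<L),\qquad u_x(t,0)=u_x(t,L)=0,\qquad u(0,\cdot)=u_0,\quad u_t(0,\cdot)=u_1$$ has a dissipative solution, that is, there is a function $u:[0,\infty)\times[0,L]\to\mathbb R$ such that 1. $u$ is continuous on $[0,\infty)\times[0,L]$; 2. the weak derivatives $u_t,u_x$ of $u$ on $(0,\infty)\times(0,L)$ exist and belong to $L^\infty(0,\infty;L^2(0,L))$; 3. for every $\varphi\in C^\infty(\mathbb R^2)$ with compact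 support $$\int_0^\infty\!\!\int_0^L\big(u\,\varphi_{tt}+u_x\varphi_x+\Phi'(u)\varphi\big)\,dx\,dt-\int_0^L u_1(x)\varphi(0,x)\,dx+\int_0^L u_0(x)\varphi_t(0,x)\,dx=0;$$ 4. for almost every $t>0$ $$\int_0^L\Big(\frac{u_t(t,x)^2+u_x(t,x)^2}{2}+\Phi(u(t,x))\Big)dx\le\int_0^L\Big(\frac{u_1(x)^2+u_0'(x)^2}{2}+\Phi(u_0(x))\Big)dx .$$ -/

import Mathlib

open MeasureTheory Set Filter Topology
open scoped ContDiff

namespace AdhesiveString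

/-- The assumptions on the adhesion potential. The last two fields say that the one-sided limits
of `Φ'` at the ends of `(-1, 1)` are finite, so that `Φ'` has at most jumps at `±1`.
Monotonicity is meant in the weak sense, and the two constants may differ. -/
structure IsAdhesionPotential (Φ : ℝ → ℝ) : Prop where
  continuous : Continuous Φ
  contDiffOn : ContDiffOn ℝ 1 Φ {1, -1}ᶜ
  const_left : ∃ c : ℝ, ∀ s ∈ Iic (-1 : ℝ), Φ s = c
  const_right : ∃ c : ℝ, ∀ s ∈ Ici (1 : ℝ), Φ s = c
  convexOn : ConvexOn ℝ (Icc (-1) 1) Φ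
  antitoneOn : AntitoneOn Φ (Icc (-1) 0)
  monotoneOn : MonotoneOn Φ (Icc 0 1)
  limit_right : ∃ l : ℝ, Tendsto (deriv Φ) (𝓝[<] 1) (𝓝 l)
  limit_left : ∃ l : ℝ, Tendsto (deriv Φ) (𝓝[>] (-1)) (𝓝 l)

/-- `g` is the weak (distributional) derivative of `f` in the direction `v` on the open set `Ω`. -/
def IsWeakDerivOn {E : Type*} [NormedAddCommGroup E] [NormedSpace ℝ E] [MeasureSpace E]
    (Ω : Set E) (v : E) (f g : E → ℝ) : Prop :=
  LocallyIntegrableOn f Ω ∧ LocallyIntegrableOn g Ω ∧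
    ∀ φ : E → ℝ, ContDiff ℝ ∞ φ → HasCompactSupport φ → tsupport φ ⊆ Ω →
      ∫ x in Ω, f x * fderiv ℝ φ x v = - ∫ x in Ω, g x * φ x

/-- `f ∈ L²(0, L)`. -/
def MemL2 (L : ℝ) (f : ℝ → ℝ) : Prop :=
  MemLp f 2 (volume.restrict (Ioo 0 L))

/-- `f ∈ H¹(0, L)` with weak derivative `f'`. -/
def IsH1With (L : ℝ) (f f' : ℝ → ℝ) : Prop :=
  MemL2 L f ∧ MemL2 L f' ∧ IsWeakDerivOn (Ioo 0 L) 1 f f'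

/-- `f ∈ H¹(0, L)`. -/
def MemH1 (L : ℝ) (f : ℝ → ℝ) : Prop :=
  ∃ f' : ℝ → ℝ, IsH1With L f f'

/-- The open space-time strip `(0, ∞) × (0, L)`; points are written `(t, x)`. -/
def strip (L : ℝ) : Set (ℝ × ℝ) := Ioi 0 ×ˢ Ioo 0 L

/-- `f ∈ L^∞(0, ∞; L²(0, L))`, for a function `f` of `(t, x)`. -/
def MemLinftyL2 (L : ℝ) (f : ℝ × ℝ → ℝ) : Prop :=
  AEStronglyMeasurable f (volume.restrict (strip L)) ∧
    ∃ C : NNReal, ∀ᵐ t ∂(volume.restrict (Ioi (0 : ℝ))),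
      eLpNorm (fun x => f (t, x)) 2 (volume.restrict (Ioo 0 L)) ≤ C

/-- The classical partial derivative in `t` (used for test functions). -/
noncomputable def dt (φ : ℝ × ℝ → ℝ) (p : ℝ × ℝ) : ℝ := fderiv ℝ φ p (1, 0)

/-- The classical partial derivative in `x` (used for test functions). -/
noncomputable def dx (φ : ℝ × ℝ → ℝ) (p : ℝ × ℝ) : ℝ := fderiv ℝ φ p (0, 1)

/-- The energy on `(0, L)` of a profile `w` with velocity `v` and slope `w'`. -/
noncomputable def energy (L : ℝ) (Φ v w' w : ℝ → ℝ) : ℝ :=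
  ∫ x in Ioo 0 L, ((v x ^ 2 + w' x ^ 2) / 2 + Φ (w x))

/-- The weak formulation of `u_tt = u_xx - Φ'(u)` with Neumann boundary conditions and initial data
`u₀`, `u₁`; here `ux` is the weak `x`-derivative of `u`. For an adhesion potential, `deriv Φ` is
the classical derivative off `±1`, and it is `0` at `±1`: there `Φ` either is not differentiable
or has derivative `0`, being constant on one side. -/
def WeakForm (L : ℝ) (Φ u₀ u₁ : ℝ → ℝ) (u ux : ℝ × ℝ → ℝ) : Prop :=
  ∀ φ : ℝ × ℝ → ℝ, ContDiff ℝ ∞ φ → HasCompactSupport φ →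
    (∫ p in strip L, (u p * dt (dt φ) p + ux p * dx φ p + deriv Φ (u p) * φ p))
      - (∫ x in Ioo 0 L, u₁ x * φ (0, x)) + (∫ x in Ioo 0 L, u₀ x * dt φ (0, x)) = 0

/-- `u` (a function of `(t, x)`, of which only the values on `[0, ∞) × [0, L]` matter) is a
dissipative solution of the Neumann problem. The weak derivatives `ut`, `ux` of `u` and `u₀'` of
`u₀` are unique up to null sets, so that it does not matter which ones are taken. -/
def IsDissipativeSolution (L : ℝ) (Φ u₀ u₁ : ℝ → ℝ) (u : ℝ × ℝ → ℝ) : Prop :=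
  ContinuousOn u (Ici 0 ×ˢ Icc 0 L) ∧
  ∃ (ut ux : ℝ × ℝ → ℝ) (u₀' : ℝ → ℝ),
    IsWeakDerivOn (strip L) (1, 0) u ut ∧
    IsWeakDerivOn (strip L) (0, 1) u ux ∧
    IsH1With L u₀ u₀' ∧
    MemLinftyL2 L ut ∧
    MemLinftyL2 L ux ∧
    WeakForm L Φ u₀ u₁ u ux ∧
    ∀ᵐ t ∂(volume.restrict (Ioi (0 : ℝ))),
      energy L Φ (fun x => ut (t, x)) (fun x => ux (t, x)) (fun x => u (t, x))
        ≤ energy L Φ u₁ u₀' u₀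

end AdhesiveString

namespace AdhesiveString

/-! ### Interval integrals depending on a parameter -/

/-! The whole difficulty is the jump of `Φ'` at `±1`: a nonlinear term that is only weakly compact
must be identified in the limit on the set where `u = ±1`.

Reflecting evenly at `0` and `L` turns the Neumann problem into a `2L`-periodic problem on the line,
where solutions are d'Alembert waves plus a Duhamel integral. Replacing `Φ'(u(t, x))` by `Φ'(u(t -
δ, x))` makes the problem explicitly solvable in time steps of length `δ`
(`exists_delayed_solution`). The delayed sources are bounded by the Lipschitz constant of `Φ`, so
along some `δ → 0` they converge weakly to a bounded `g`. A Duhamel integral is an integral of the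
source over a bounded triangle, hence the solutions converge at every point to the wave `u` with
source `g`.

Where `u ≠ ±1`, `Φ'` is continuous at `u` and the sources converge pointwise, so `g = -Φ'(u)` almost
everywhere there. Where `u = ±1`, the limit is identified by `ae_source_eq_zero_of_level`. Almost
everywhere on a level set `u_t = u_x = 0`, so `(u_t + u_x) / 2` vanishes there. Along a
characteristic `x + t = a` this quantity is absolutely continuous with derivative `g / 2`, so almost
everywhere on its own zero set `g = 0`. Since `Φ'(±1) = 0` by convention, `g = -Φ'(u)` almost
everywhere (`exists_mild_solution`).

The rest is calculus along characteristics. By evenness `(u_t + u_x) / 2`, as a function of the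
label `a` on a period, carries both `u_t` and `u_x`. Its square integrates to the kinetic plus
elastic energy, and its transport equation gives the energy balance (`kinetic_energy_identity`) and
the weak form (`integral_velocity_dt_sub_slope_dx`). The chain rule for `Φ(u)` survives the corners
of `Φ`, again because derivatives vanish on level sets, so the energy is conserved exactly, which is
more than the required inequality. -/

lemma integrableOn_of_abs_le {α : Type*} [MeasurableSpace α] {μ : Measure α} {f : α → ℝ} {M : ℝ}
    {s : Set α} (hf : Measurable f) (hM : ∀ z, |f z| ≤ M) (hs : μ s ≠ ⊤) : IntegrableOn f s μ :=
  Measure.integrableOn_of_bounded (M := M) hs hf.aestronglyMeasurable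
    (Eventually.of_forall fun z => by simpa using hM z)

lemma intervalIntegrable_of_abs_le {f : ℝ → ℝ} {M : ℝ} (hf : Measurable f)
    (hM : ∀ z, |f z| ≤ M) (a b : ℝ) : IntervalIntegrable f volume a b :=
  ⟨integrableOn_of_abs_le hf hM (by simp), integrableOn_of_abs_le hf hM (by simp)⟩

lemma abs_intervalIntegral_le {f : ℝ → ℝ} {M : ℝ} (hM : ∀ z, |f z| ≤ M) (a b : ℝ) :
    |∫ x in a..b, f x| ≤ M * |b - a| := by
  rw [← Real.norm_eq_abs]
  exact intervalIntegral.norm_integral_le_of_norm_le_const fun z _ => hM z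

/-- Moving endpoints are absorbed into the indicator of a measurable set in the product, after which
this is measurability of a parametric integral over the whole line. -/
lemma measurable_intervalIntegral {α : Type*} [MeasurableSpace α] {h : α → ℝ → ℝ}
    (hh : Measurable (Function.uncurry h)) {a b : α → ℝ} (ha : Measurable a) (hb : Measurable b) :
    Measurable fun z => ∫ s in (a z)..(b z), h z s := by
  have key : ∀ {a b : α → ℝ}, Measurable a → Measurable b →
      Measurable fun z => ∫ s in Ioc (a z) (b z), h z s := by
    intro a b ha hb
    have hset : MeasurableSet {q : α × ℝ | a q.1 < q.2 ∧ q.2 ≤ b q.1} :=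
      (measurableSet_lt (ha.comp measurable_fst) measurable_snd).inter
        (measurableSet_le measurable_snd (hb.comp measurable_fst))
    have h1 : Measurable fun z => ∫ s, ({q : α × ℝ | a q.1 < q.2 ∧ q.2 ≤ b q.1}.indicator
        (Function.uncurry h)) (z, s) :=
      ((hh.indicator hset).stronglyMeasurable.integral_prod_right').measurable
    convert h1 using 2 with z
    rw [← integral_indicator measurableSet_Ioc]
    congr 1
  exact (key ha hb).sub (key hb ha)

lemma intervalIntegral_swap {h : ℝ → ℝ → ℝ} {a b c d : ℝ}
    (hi : IntegrableOn (fun z : ℝ × ℝ => h z.1 z.2) (uIoc a b ×ˢ uIoc c d)) :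
    ∫ s in a..b, ∫ t in c..d, h s t = ∫ t in c..d, ∫ s in a..b, h s t := by
  have hi' : Integrable (Function.uncurry h)
      ((volume.restrict (uIoc a b)).prod (volume.restrict (uIoc c d))) := by
    rw [Measure.prod_restrict]
    exact hi
  simp only [intervalIntegral.intervalIntegral_eq_integral_uIoc]
  simp only [smul_eq_mul, integral_const_mul]
  rw [integral_integral_swap hi']
  ring

lemma intervalIntegral_swap_of_abs_le {h : ℝ → ℝ → ℝ} {M : ℝ}
    (hh : Measurable (Function.uncurry h)) (hM : ∀ s t, |h s t| ≤ M) (a b c d : ℝ) :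
    ∫ s in a..b, ∫ t in c..d, h s t = ∫ t in c..d, ∫ s in a..b, h s t := by
  refine intervalIntegral_swap (integrableOn_of_abs_le (M := M) hh (fun z => hM z.1 z.2) ?_)
  rw [Measure.volume_eq_prod, Measure.prod_prod]
  simp [uIoc, ENNReal.mul_eq_top]

/-- Fubini's theorem on the triangle `0 < s ≤ t ≤ T`. -/
lemma intervalIntegral_swap_triangle {h : ℝ → ℝ → ℝ} {M : ℝ}
    (hh : Measurable (Function.uncurry h)) (hM : ∀ s t, |h s t| ≤ M) {T : ℝ} (hT : 0 ≤ T) :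
    ∫ t in (0 : ℝ)..T, ∫ s in (0 : ℝ)..t, h s t = ∫ s in (0 : ℝ)..T, ∫ t in s..T, h s t := by
  -- Extension by zero off the triangle reduces the claim to Fubini on the square.
  set k : ℝ → ℝ → ℝ := fun s t => if s < t then h s t else 0
  have hk : Measurable (Function.uncurry k) :=
    Measurable.ite (measurableSet_lt measurable_fst measurable_snd) hh measurable_const
  have hkM : ∀ s t, |k s t| ≤ M := by
    intro s t
    by_cases hst : s < t
    · simpa [k, hst] using hM s t
    · simpa [k, hst] using (abs_nonneg _).trans (hM s t)
  have h1 : ∀ t ∈ uIcc 0 T, ∫ s in (0 : ℝ)..t, h s t = ∫ s in (0 : ℝ)..T, k s t := by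
    intro t ht
    rw [uIcc_of_le hT] at ht
    have hm : Measurable fun s => k s t := hk.comp (measurable_id.prodMk measurable_const)
    rw [← intervalIntegral.integral_add_adjacent_intervals
      (intervalIntegrable_of_abs_le hm (fun s => hkM s t) 0 t)
      (intervalIntegrable_of_abs_le hm (fun s => hkM s t) t T)]
    have e1 : ∫ s in t..T, k s t = 0 := by
      rw [intervalIntegral.integral_of_le ht.2]
      exact setIntegral_eq_zero_of_forall_eq_zero fun s hs => if_neg (not_lt.2 hs.1.le)
    rw [e1, add_zero, intervalIntegral.integral_of_le ht.1, intervalIntegral.integral_of_le ht.1,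
      integral_Ioc_eq_integral_Ioo, integral_Ioc_eq_integral_Ioo]
    exact setIntegral_congr_fun measurableSet_Ioo fun s hs => (if_pos hs.2).symm
  have h2 : ∀ s ∈ uIcc 0 T, ∫ t in s..T, h s t = ∫ t in (0 : ℝ)..T, k s t := by
    intro s hs
    rw [uIcc_of_le hT] at hs
    have hm : Measurable fun t => k s t := hk.comp (measurable_const.prodMk measurable_id)
    rw [← intervalIntegral.integral_add_adjacent_intervals
      (intervalIntegrable_of_abs_le hm (fun t => hkM s t) 0 s)
      (intervalIntegrable_of_abs_le hm (fun t => hkM s t) s T)]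
    have e1 : ∫ t in (0 : ℝ)..s, k s t = 0 := by
      rw [intervalIntegral.integral_of_le hs.1]
      exact setIntegral_eq_zero_of_forall_eq_zero fun t ht => if_neg (not_lt.2 ht.2)
    rw [e1, zero_add, intervalIntegral.integral_of_le hs.2, intervalIntegral.integral_of_le hs.2]
    exact setIntegral_congr_fun measurableSet_Ioc fun t ht => (if_pos ht.1).symm
  rw [intervalIntegral.integral_congr h1, intervalIntegral.integral_congr h2]
  exact intervalIntegral_swap_of_abs_le (h := fun t s => k s t)
    (hk.comp measurable_swap) (fun t s => hkM s t) _ _ _ _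

lemma intervalIntegral_symm_eq {h : ℝ → ℝ} {L : ℝ} (hh : IntervalIntegrable h volume (-L) L)
    (hL : 0 ≤ L) : ∫ y in (-L)..L, h y = ∫ y in (0 : ℝ)..L, (h y + h (-y)) := by
  have hs1 : IntervalIntegrable h volume 0 L :=
    hh.mono_set (by rw [uIcc_of_le hL, uIcc_of_le (by linarith)]; exact Icc_subset_Icc_left (by linarith))
  have hs2 : IntervalIntegrable h volume (-L) 0 :=
    hh.mono_set (by rw [uIcc_of_le (by linarith), uIcc_of_le (by linarith)]; exact Icc_subset_Icc_right hL)
  have hs3 : IntervalIntegrable (fun y => h (-y)) volume 0 L := by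
    simpa using (hs2.comp_sub_left 0).symm
  rw [intervalIntegral.integral_add hs1 hs3, intervalIntegral.integral_comp_neg, neg_zero, add_comm,
    intervalIntegral.integral_add_adjacent_intervals hs2 hs1]

/-! ### Absolutely continuous functions -/

lemma ae_hasDerivAt_of_eq_primitive {y a : ℝ → ℝ} {T : ℝ} (hT : 0 ≤ T)
    (ha : IntervalIntegrable a volume 0 T)
    (hy : ∀ t ∈ Icc 0 T, y t = y 0 + ∫ s in (0 : ℝ)..t, a s) :
    ∀ᵐ t, t ∈ Ioo 0 T → HasDerivAt y (a t) t := by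
  filter_upwards [ha.ae_hasDerivAt_integral] with t ht htT
  have h0 := (ht (by rw [uIcc_of_le hT]; exact Ioo_subset_Icc_self htT) 0 (by simp)).const_add (y 0)
  refine h0.congr_of_eventuallyEq ?_
  filter_upwards [Ioo_mem_nhds htT.1 htT.2] with s hs
  exact hy s (Ioo_subset_Icc_self hs)

lemma absolutelyContinuous_of_eq_primitive {y a : ℝ → ℝ} {T : ℝ} (hT : 0 ≤ T)
    (ha : IntervalIntegrable a volume 0 T)
    (hy : ∀ t ∈ Icc 0 T, y t = y 0 + ∫ s in (0 : ℝ)..t, a s) :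
    AbsolutelyContinuousOnInterval y 0 T := by
  have h1 := ha.absolutelyContinuousOnInterval_intervalIntegral (c := 0) (by simp)
  rw [absolutelyContinuousOnInterval_iff] at h1 ⊢
  intro ε hε
  obtain ⟨δ, hδ, h⟩ := h1 ε hε
  refine ⟨δ, hδ, fun E hE hlt => ?_⟩
  refine lt_of_le_of_lt (le_of_eq (Finset.sum_congr rfl fun i hi => ?_)) (h E hE hlt)
  have := hE.1 i hi
  rw [uIcc_of_le hT] at this
  rw [hy _ this.1, hy _ this.2, dist_add_left]

lemma LipschitzWith.comp_absolutelyContinuous {Φ y : ℝ → ℝ} {K : NNReal} {a b : ℝ}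
    (hΦ : LipschitzWith K Φ) (hy : AbsolutelyContinuousOnInterval y a b) :
    AbsolutelyContinuousOnInterval (fun t => Φ (y t)) a b := by
  rw [absolutelyContinuousOnInterval_iff] at hy ⊢
  intro ε hε
  -- `K + 1` instead of `K` avoids a separate case `K = 0`.
  obtain ⟨δ, hδ, h⟩ := hy (ε / (K + 1)) (by positivity)
  refine ⟨δ, hδ, fun E hE hlt => ?_⟩
  have h1 := h E hE hlt
  have hK : (0 : ℝ) < K + 1 := by positivity
  calc ∑ i ∈ Finset.range E.1, dist (Φ (y (E.2 i).1)) (Φ (y (E.2 i).2))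
      ≤ ∑ i ∈ Finset.range E.1, ((K : ℝ) + 1) * dist (y (E.2 i).1) (y (E.2 i).2) := by
        refine Finset.sum_le_sum fun i _ => (hΦ.dist_le_mul _ _).trans ?_
        gcongr
        linarith
    _ = (K + 1) * ∑ i ∈ Finset.range E.1, dist (y (E.2 i).1) (y (E.2 i).2) := by
        rw [Finset.mul_sum]
    _ < (K + 1) * (ε / (K + 1)) := by gcongr
    _ = ε := by field_simp

/-- Integration by parts for primitives of integrable functions. -/
lemma integral_mul_eq_of_eq_primitive {A B a b : ℝ → ℝ} {T : ℝ} (hT : 0 ≤ T)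
    (ha : IntervalIntegrable a volume 0 T) (hb : IntervalIntegrable b volume 0 T)
    (hA : ∀ t ∈ Icc 0 T, A t = A 0 + ∫ s in (0 : ℝ)..t, a s)
    (hB : ∀ t ∈ Icc 0 T, B t = B 0 + ∫ s in (0 : ℝ)..t, b s) :
    ∫ t in (0 : ℝ)..T, A t * b t = A T * B T - A 0 * B 0 - ∫ t in (0 : ℝ)..T, a t * B t := by
  have h1 := (absolutelyContinuous_of_eq_primitive hT ha hA).integral_mul_deriv_eq_deriv_mul
    (absolutelyContinuous_of_eq_primitive hT hb hB)
  have hne : ∀ᵐ t : ℝ, t ≠ T := by simp [ae_iff, measure_singleton]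
  have e1 : ∫ t in (0 : ℝ)..T, A t * b t = ∫ t in (0 : ℝ)..T, A t * deriv B t := by
    refine intervalIntegral.integral_congr_ae ?_
    filter_upwards [ae_hasDerivAt_of_eq_primitive hT hb hB, hne] with t ht htT hmem
    rw [uIoc_of_le hT] at hmem
    rw [(ht ⟨hmem.1, lt_of_le_of_ne hmem.2 htT⟩).deriv]
  have e2 : ∫ t in (0 : ℝ)..T, a t * B t = ∫ t in (0 : ℝ)..T, deriv A t * B t := by
    refine intervalIntegral.integral_congr_ae ?_
    filter_upwards [ae_hasDerivAt_of_eq_primitive hT ha hA, hne] with t ht htT hmem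
    rw [uIoc_of_le hT] at hmem
    rw [(ht ⟨hmem.1, lt_of_le_of_ne hmem.2 htT⟩).deriv]
  rw [e1, e2, h1]

/-- Near a point with nonzero derivative the value `c` is not taken again, so the point is isolated
in the level set; a subset of the line has only countably many points that are isolated from the
right. -/
lemma countable_level_deriv_ne_zero (y : ℝ → ℝ) (c : ℝ) :
    {t | y t = c ∧ ∃ d, d ≠ 0 ∧ HasDerivAt y d t}.Countable := by
  refine (countable_setOfPred_isolated_right_within (s := {t | y t = c})).mono ?_
  rintro t ⟨htc, d, hd, hder⟩
  refine ⟨htc, ?_⟩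
  have h1 := hder.eventually_ne (c := c) hd
  have hsub : {t | y t = c} ∩ Ioi t ⊆ {t}ᶜ := fun s hs => ne_of_gt hs.2
  rw [← Filter.eventually_false_iff_eq_bot]
  filter_upwards [nhdsWithin_mono t hsub h1, self_mem_nhdsWithin] with s hs hs'
  exact hs hs'.1

/-- A differentiable function has derivative `0` at almost every point of a level set. -/
lemma ae_deriv_eq_zero_of_level (y : ℝ → ℝ) (c : ℝ) :
    ∀ᵐ t, ∀ d, y t = c → HasDerivAt y d t → d = 0 := by
  filter_upwards [(countable_level_deriv_ne_zero y c).ae_notMem volume] with t ht d hc hd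
  by_contra h
  exact ht ⟨hc, d, h, hd⟩

/-- Chain rule for a Lipschitz function which is differentiable off `±1`. -/
lemma integral_deriv_comp_mul {Φ y a : ℝ → ℝ} {K : NNReal} (hΦ : LipschitzWith K Φ)
    (hd : ∀ s, s ≠ 1 → s ≠ -1 → DifferentiableAt ℝ Φ s) {T : ℝ} (hT : 0 ≤ T)
    (ha : IntervalIntegrable a volume 0 T)
    (hy : ∀ t ∈ Icc 0 T, y t = y 0 + ∫ s in (0 : ℝ)..t, a s) :
    ∫ t in (0 : ℝ)..T, deriv Φ (y t) * a t = Φ (y T) - Φ (y 0) := by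
  have hac := LipschitzWith.comp_absolutelyContinuous hΦ
    (absolutelyContinuous_of_eq_primitive hT ha hy)
  rw [← hac.integral_deriv_eq_sub]
  refine intervalIntegral.integral_congr_ae ?_
  have hne : ∀ᵐ t : ℝ, t ≠ T := by simp [ae_iff, measure_singleton]
  filter_upwards [ae_hasDerivAt_of_eq_primitive hT ha hy, hne, ae_deriv_eq_zero_of_level y 1,
    ae_deriv_eq_zero_of_level y (-1)] with t ht htT h1 h2 hmem
  rw [uIoc_of_le hT] at hmem
  have hder := ht ⟨hmem.1, lt_of_le_of_ne hmem.2 htT⟩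
  -- At a corner of `Φ` the derivative of `y` is `0` for almost every such `t`. The Lipschitz bound
  -- then gives `Φ ∘ y` derivative `0`, whatever value `deriv Φ` takes at the corner.
  by_cases hyt : y t = 1 ∨ y t = -1
  · have ha0 : a t = 0 := hyt.elim (fun h => h1 _ h hder) fun h => h2 _ h hder
    rw [ha0] at hder
    have : HasDerivAt (fun t => Φ (y t)) 0 t := by
      rw [hasDerivAt_iff_isLittleO] at hder ⊢
      simp only [smul_zero, sub_zero] at hder ⊢
      refine (Asymptotics.IsBigO.of_bound K (Eventually.of_forall fun s => ?_)).trans_isLittleO hder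
      simpa [dist_eq_norm] using hΦ.dist_le_mul (y s) (y t)
    rw [this.deriv, ha0, mul_zero]
  · push Not at hyt
    exact ((hd _ hyt.1 hyt.2).hasDerivAt.comp t hder).deriv.symm

/-! ### Weak compactness of bounded sequences of functions on the plane -/

/-- An auxiliary positive weight in `L²(ℝ²)`. -/
noncomputable def planeWeight (z : ℝ × ℝ) : ℝ := (1 + z.1 ^ 2)⁻¹ * (1 + z.2 ^ 2)⁻¹

lemma planeWeight_pos (z : ℝ × ℝ) : 0 < planeWeight z := by
  unfold planeWeight; positivity

lemma continuous_planeWeight : Continuous planeWeight := by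
  unfold planeWeight
  refine Continuous.mul ?_ ?_ <;>
  exact Continuous.inv₀ (by fun_prop) fun z => by positivity

lemma memLp_planeWeight : MemLp planeWeight 2 volume := by
  rw [memLp_two_iff_integrable_sq continuous_planeWeight.aestronglyMeasurable]
  have h1 : Integrable planeWeight volume :=
    Integrable.mul_prod integrable_inv_one_add_sq integrable_inv_one_add_sq
  refine h1.mono' (continuous_planeWeight.pow 2).aestronglyMeasurable
    (Eventually.of_forall fun z => ?_)
  have h0 := planeWeight_pos z
  have h2 : planeWeight z ≤ 1 := by
    unfold planeWeight
    exact mul_le_one₀ (inv_le_one_of_one_le₀ (by nlinarith [sq_nonneg z.1])) (by positivity)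
      (inv_le_one_of_one_le₀ (by nlinarith [sq_nonneg z.2]))
  rw [Real.norm_of_nonneg (by positivity)]
  nlinarith

/-- Bounded sequences in a separable Hilbert space have weakly convergent subsequences. -/
lemma exists_subseq_tendsto_inner {E : Type*} [NormedAddCommGroup E] [InnerProductSpace ℝ E]
    [CompleteSpace E] [TopologicalSpace.SeparableSpace E] {x : ℕ → E} {C : ℝ}
    (hx : ∀ n, ‖x n‖ ≤ C) : ∃ φ : ℕ → ℕ, StrictMono φ ∧ ∃ a : E, ∀ v : E,
      Tendsto (fun n => inner ℝ (x (φ n)) v) atTop (𝓝 (inner ℝ a v)) := by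
  have hmem : ∀ n, StrongDual.toWeakDual (InnerProductSpace.toDual ℝ E (x n)) ∈
      WeakDual.toStrongDual ⁻¹' Metric.closedBall (0 : StrongDual ℝ E) C := by
    intro n
    rw [mem_preimage, mem_closedBall_zero_iff]
    exact ((InnerProductSpace.toDual ℝ E).norm_map (x n)).le.trans (hx n)
  obtain ⟨l, -, φ, hφ, hlim⟩ := WeakDual.isSeqCompact_closedBall ℝ E 0 C hmem
  refine ⟨φ, hφ, (InnerProductSpace.toDual ℝ E).symm (WeakDual.toStrongDual l), fun v => ?_⟩
  have h1 := ((WeakDual.eval_continuous v).tendsto l).comp hlim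
  rw [InnerProductSpace.toDual_symm_apply]
  exact h1

/-- Multiplication by `planeWeight` places the bounded sequence in a ball of `L²(ℝ²)`, where weak
compactness is available. Testing the weak limit with `1_A / planeWeight`, square integrable for
bounded `A`, removes the weight again. -/
lemma exists_weak_limit {f : ℕ → ℝ × ℝ → ℝ} {M : ℝ} (hf : ∀ n, Measurable (f n))
    (hM : ∀ n z, |f n z| ≤ M) :
    ∃ φ : ℕ → ℕ, StrictMono φ ∧ ∃ g : ℝ × ℝ → ℝ, Measurable g ∧ (∀ z, |g z| ≤ M) ∧
      ∀ A, MeasurableSet A → Bornology.IsBounded A →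
        Tendsto (fun n => ∫ z in A, f (φ n) z) atTop (𝓝 (∫ z in A, g z)) := by
  have hM0 : 0 ≤ M := (abs_nonneg _).trans (hM 0 0)
  have hFle : ∀ n, ∀ z, ‖f n z * planeWeight z‖ ≤ M * ‖planeWeight z‖ := fun n z => by
    rw [norm_mul]
    exact mul_le_mul_of_nonneg_right (hM n z) (norm_nonneg _)
  have hF : ∀ n, MemLp (fun z => f n z * planeWeight z) 2 volume := fun n =>
    memLp_planeWeight.of_le_mul
      ((hf n).mul continuous_planeWeight.measurable).aestronglyMeasurable
      (Eventually.of_forall (hFle n))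
  have hnorm : ∀ n, ‖(hF n).toLp _‖ ≤ M * ‖memLp_planeWeight.toLp _‖ := fun n => by
    refine Lp.norm_le_mul_norm_of_ae_le_mul ?_
    filter_upwards [(hF n).coeFn_toLp, memLp_planeWeight.coeFn_toLp] with z h1 h2
    rw [h1, h2]
    exact hFle n z
  have : Fact ((2 : ENNReal) ≠ ⊤) := ⟨by norm_num⟩
  obtain ⟨φ, hφ, G, hG⟩ := exists_subseq_tendsto_inner hnorm
  have hlim : ∀ k : ℝ × ℝ → ℝ, MemLp k 2 volume →
      Tendsto (fun n => ∫ z, f (φ n) z * planeWeight z * k z) atTop (𝓝 (∫ z, G z * k z)) := by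
    intro k hk
    have h1 := hG (hk.toLp k)
    have e1 : ∀ n, inner ℝ ((hF (φ n)).toLp _) (hk.toLp k)
        = ∫ z, f (φ n) z * planeWeight z * k z := by
      intro n
      rw [L2.inner_def]
      refine integral_congr_ae ?_
      filter_upwards [(hF (φ n)).coeFn_toLp, hk.coeFn_toLp] with z h1 h2
      rw [h1, h2]
      simp [mul_comm]
    have e2 : inner ℝ G (hk.toLp k) = ∫ z, G z * k z := by
      rw [L2.inner_def]
      refine integral_congr_ae ?_
      filter_upwards [hk.coeFn_toLp] with z h2
      rw [h2]
      simp [mul_comm]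
    simpa only [e1, e2] using h1
  have hGmem : MemLp G 2 volume := Lp.memLp G
  have hset : ∀ s : Set (ℝ × ℝ), MeasurableSet s → volume s < ⊤ →
      Tendsto (fun n => ∫ z in s, f (φ n) z * planeWeight z) atTop (𝓝 (∫ z in s, G z)) := by
    intro s hs hμ
    have h1 := hlim (s.indicator fun _ => 1) (memLp_indicator_const 2 hs 1 (Or.inr hμ.ne))
    have e : ∀ q : ℝ × ℝ → ℝ, ∫ z, q z * s.indicator (fun _ => (1 : ℝ)) z = ∫ z in s, q z := by
      intro q
      rw [← integral_indicator hs]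
      congr 1
      funext z
      by_cases hz : z ∈ s <;> simp [hz]
    simpa only [e] using h1
  have hon : ∀ q : ℝ × ℝ → ℝ, MemLp q 2 volume → ∀ s : Set (ℝ × ℝ), volume s < ⊤ →
      IntegrableOn q s := by
    intro q hq s hμ
    have : IsFiniteMeasure (volume.restrict s) := ⟨by simpa using hμ⟩
    exact (hq.restrict s).integrable (by norm_num)
  -- Both signs together say `|G| ≤ M * planeWeight` almost everywhere; the inequality passes to the
  -- limit in integrals over sets of finite measure.
  have hbd : ∀ ε : ℝ, (ε = 1 ∨ ε = -1) → 0 ≤ᵐ[volume] fun z => M * planeWeight z - ε * G z := by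
    intro ε hε
    refine ae_nonneg_of_forall_setIntegral_nonneg_of_sigmaFinite (fun s _ hμ => ?_)
      fun s hs hμ => ?_
    · exact ((hon _ memLp_planeWeight s hμ).const_mul M).sub ((hon _ hGmem s hμ).const_mul ε)
    · rw [integral_sub ((hon _ memLp_planeWeight s hμ).const_mul M)
        ((hon _ hGmem s hμ).const_mul ε), integral_const_mul ε]
      refine ge_of_tendsto' ((tendsto_const_nhds (x := ∫ z in s, M * planeWeight z)).sub
        ((hset s hs hμ).const_mul ε)) fun n => ?_
      rw [← integral_const_mul ε, ← integral_sub ((hon _ memLp_planeWeight s hμ).const_mul M)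
        ((hon _ (hF _) s hμ).const_mul ε)]
      refine integral_nonneg fun z => ?_
      have h1 := abs_le.1 (hM (φ n) z)
      have h2 := planeWeight_pos z
      rcases hε with rfl | rfl <;> simp only [Pi.zero_apply] <;> nlinarith
  obtain ⟨g, hgm, hgG⟩ : ∃ g : ℝ × ℝ → ℝ, Measurable g ∧ g =ᵐ[volume] G :=
    ⟨_, hGmem.1.aemeasurable.measurable_mk, hGmem.1.aemeasurable.ae_eq_mk.symm⟩
  -- Truncation changes the quotient only on a null set and makes the bound hold at every point.
  refine ⟨φ, hφ, fun z => max (-M) (min M (g z / planeWeight z)), ?_, fun z => ?_,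
    fun A hA hAb => ?_⟩
  · exact measurable_const.max (measurable_const.min (hgm.div continuous_planeWeight.measurable))
  · rw [abs_le]
    exact ⟨le_max_left _ _, max_le (by linarith) (min_le_left _ _)⟩
  · obtain ⟨C, hC⟩ := (Metric.isCompact_of_isClosed_isBounded isClosed_closure
      hAb.closure).exists_bound_of_continuousOn
      (continuous_planeWeight.inv₀ fun z => (planeWeight_pos z).ne').continuousOn
    have hk : MemLp (A.indicator fun z => (planeWeight z)⁻¹) 2 volume := by
      refine (memLp_indicator_const 2 hA (1 : ℝ) (Or.inr hAb.measure_lt_top.ne)).of_le_mul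
        (c := C) ?_ (Eventually.of_forall fun z => ?_)
      · exact ((continuous_planeWeight.measurable.inv).indicator hA).aestronglyMeasurable
      · by_cases hz : z ∈ A
        · simpa [hz] using hC z (subset_closure hz)
        · simp [hz]
    have h1 := hlim _ hk
    have e1 : ∀ n, ∫ z, f (φ n) z * planeWeight z * A.indicator (fun z => (planeWeight z)⁻¹) z
        = ∫ z in A, f (φ n) z := by
      intro n
      rw [← integral_indicator hA]
      congr 1
      funext z
      by_cases hz : z ∈ A
      · have := (planeWeight_pos z).ne'
        simp only [hz, indicator_of_mem]
        field_simp
      · simp [hz]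
    have e2 : ∫ z, G z * A.indicator (fun z => (planeWeight z)⁻¹) z
        = ∫ z in A, max (-M) (min M (g z / planeWeight z)) := by
      rw [← integral_indicator hA]
      refine integral_congr_ae ?_
      filter_upwards [hgG, hbd 1 (Or.inl rfl), hbd (-1) (Or.inr rfl)] with z h0 h1 h2
      by_cases hz : z ∈ A
      · have hp := planeWeight_pos z
        simp only [hz, indicator_of_mem]
        simp only [Pi.zero_apply] at h1 h2
        rw [h0, min_eq_right (by rw [div_le_iff₀ hp]; linarith),
          max_eq_right (by rw [le_div_iff₀ hp]; linarith), div_eq_mul_inv]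
      · simp [hz]
    simpa only [e1, e2] using h1

lemma intervalIntegral_eq_integral_Ioo {f : ℝ → ℝ} {a b : ℝ} (hab : a ≤ b) :
    ∫ x in a..b, f x = ∫ x in Ioo a b, f x := by
  rw [intervalIntegral.integral_of_le hab, integral_Ioc_eq_integral_Ioo]

/-! ### The du Bois-Reymond lemma on an interval -/

lemma exists_contDiff_bump {L : ℝ} (hL : 0 < L) : ∃ χ : ℝ → ℝ, ContDiff ℝ ∞ χ ∧
    HasCompactSupport χ ∧ tsupport χ ⊆ Ioo 0 L ∧ ∫ x, χ x = 1 := by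
  let b : ContDiffBump (L / 2) := ⟨L / 8, L / 4, by positivity, by linarith⟩
  refine ⟨b.normed volume, b.contDiff_normed, b.hasCompactSupport_normed, ?_, b.integral_normed⟩
  rw [b.tsupport_normed_eq]
  intro x hx
  rw [Metric.mem_closedBall, Real.dist_eq, abs_le] at hx
  have h1 : -(L / 4) ≤ x - L / 2 := hx.1
  have h2 : x - L / 2 ≤ L / 4 := hx.2
  constructor <;> linarith

/-- A smooth function with compact support in `(0, L)` and mean zero has a primitive of the same
kind. -/
lemma exists_primitive_of_integral_eq_zero {L : ℝ} {ψ : ℝ → ℝ} (hψ : ContDiff ℝ ∞ ψ)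
    (hψc : HasCompactSupport ψ) (hψs : tsupport ψ ⊆ Ioo 0 L) (h0 : ∫ x, ψ x = 0) :
    ∃ φ : ℝ → ℝ, ContDiff ℝ ∞ φ ∧ HasCompactSupport φ ∧ tsupport φ ⊆ Ioo 0 L ∧
      ∀ x, HasDerivAt φ (ψ x) x := by
  have hi : ∀ a b, IntervalIntegrable ψ volume a b := fun a b =>
    hψ.continuous.intervalIntegrable a b
  have hder : ∀ x, HasDerivAt (fun x => ∫ s in (0 : ℝ)..x, ψ s) (ψ x) x := fun x =>
    intervalIntegral.integral_hasDerivAt_right (hi _ _)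
      hψ.continuous.aestronglyMeasurable.stronglyMeasurableAtFilter hψ.continuous.continuousAt
  have hsm : ContDiff ℝ ∞ (fun x => ∫ s in (0 : ℝ)..x, ψ s) := by
    rw [contDiff_infty_iff_deriv]
    refine ⟨fun x => (hder x).differentiableAt, ?_⟩
    rwa [show deriv (fun x => ∫ s in (0 : ℝ)..x, ψ s) = ψ from funext fun x => (hder x).deriv]
  have hψ0 : ∀ x, x ∉ tsupport ψ → ψ x = 0 := fun x hx => image_eq_zero_of_notMem_tsupport hx
  rcases (tsupport ψ).eq_empty_or_nonempty with he | hne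
  · have hz : ψ = 0 := funext fun x => hψ0 x (by simp [he])
    refine ⟨0, contDiff_const, HasCompactSupport.zero, by simp, fun x => ?_⟩
    rw [hz]
    exact hasDerivAt_const x 0
  obtain ⟨a, ha, hamin⟩ := IsCompact.exists_isLeast hψc hne
  obtain ⟨b, hb, hbmax⟩ := IsCompact.exists_isGreatest hψc hne
  have haL := hψs ha
  have hbL := hψs hb
  have hzl : ∀ x, x < a → ∫ s in (0 : ℝ)..x, ψ s = 0 := by
    intro x hx
    refine intervalIntegral.integral_zero_ae (Eventually.of_forall fun s hs => hψ0 s fun hs' => ?_)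
    have := hamin hs'
    rw [mem_uIoc] at hs
    rcases hs with hs | hs <;> linarith [haL.1]
  -- The mean-zero hypothesis enters here: to the right of the support the primitive equals the full
  -- integral.
  have hzr : ∀ x, b < x → ∫ s in (0 : ℝ)..x, ψ s = 0 := by
    intro x hx
    rw [intervalIntegral.integral_eq_integral_of_support_subset, h0]
    intro s hs
    have hs' := subset_tsupport ψ hs
    exact ⟨haL.1.trans_le (hamin hs'), (hbmax hs').trans hx.le⟩
  have hsub : tsupport (fun x => ∫ s in (0 : ℝ)..x, ψ s) ⊆ Icc a b := by
    refine closure_minimal (fun x hx => ?_) isClosed_Icc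
    by_contra hx'
    rw [mem_Icc, not_and_or, not_le, not_le] at hx'
    exact hx (hx'.elim (hzl x) (hzr x))
  exact ⟨_, hsm, HasCompactSupport.of_support_subset_isCompact isCompact_Icc
    ((subset_tsupport _).trans hsub), hsub.trans fun x hx => ⟨haL.1.trans_le hx.1,
      hx.2.trans_lt hbL.2⟩, hder⟩

/-- For a test function `ψ` with integral `m` and a fixed bump `χ` of integral `1`, the difference
`ψ - m χ` has mean zero and is therefore the derivative of a test function. Hence `∫ w ψ = m ∫ w χ`,
so `w - ∫ w χ` is orthogonal to all test functions. -/
lemma ae_eq_const_of_integral_mul_deriv {L : ℝ} (hL : 0 < L) {w : ℝ → ℝ}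
    (hw : IntegrableOn w (Ioo 0 L))
    (h : ∀ φ ψ : ℝ → ℝ, ContDiff ℝ ∞ φ → HasCompactSupport φ → tsupport φ ⊆ Ioo 0 L →
      (∀ x, HasDerivAt φ (ψ x) x) → Continuous ψ → ∫ x in Ioo 0 L, w x * ψ x = 0) :
    ∃ c, ∀ᵐ x, x ∈ Ioo 0 L → w x = c := by
  obtain ⟨χ, hχ, hχc, hχs, hχ1⟩ := exists_contDiff_bump hL
  have hmul : ∀ q : ℝ → ℝ, Continuous q → HasCompactSupport q →
      IntegrableOn (fun x => w x * q x) (Ioo 0 L) := by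
    intro q hq hqc
    obtain ⟨C, hC⟩ := hqc.exists_bound_of_continuous hq
    exact hw.mul_bdd hq.aestronglyMeasurable (Eventually.of_forall hC)
  set c := ∫ x in Ioo 0 L, w x * χ x
  refine ⟨c, ?_⟩
  have key : ∀ᵐ x, x ∈ Ioo 0 L → w x - c = 0 := by
    refine isOpen_Ioo.ae_eq_zero_of_integral_contDiff_smul_eq_zero ?_ fun ψ hψ hψc hψs => ?_
    · exact (hw.sub (integrableOn_const (by simp))).locallyIntegrableOn
    · have hψi := hψ.continuous.integrable_of_hasCompactSupport hψc (μ := volume)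
      have hχi := hχ.continuous.integrable_of_hasCompactSupport hχc (μ := volume)
      set m := ∫ x, ψ x
      obtain ⟨φ, hφ, hφc, hφs, hφd⟩ := exists_primitive_of_integral_eq_zero (L := L)
        (ψ := fun x => ψ x - m * χ x) (hψ.sub (contDiff_const.mul hχ))
        (hψc.sub (hχc.mul_left))
        (by
          refine (tsupport_sub ψ (fun x => m * χ x)).trans (union_subset hψs ?_)
          exact (tsupport_mul_subset_right (f := fun _ => m) (g := χ)).trans hχs)
        (by rw [integral_sub hψi (hχi.const_mul m), integral_const_mul, hχ1]; simp [m])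
      have h1 := h φ _ hφ hφc hφs hφd (hψ.continuous.sub (continuous_const.mul hχ.continuous))
      have e0 : ∀ x, x ∉ Ioo 0 L → ψ x • (w x - c) = 0 := fun x hx => by
        rw [image_eq_zero_of_notMem_tsupport fun hx' => hx (hψs hx'), zero_smul]
      rw [← setIntegral_eq_integral_of_forall_compl_eq_zero e0]
      have e1 : ∫ x in Ioo 0 L, ψ x = m := setIntegral_eq_integral_of_forall_compl_eq_zero
        fun x hx => image_eq_zero_of_notMem_tsupport fun hx' => hx (hψs hx')
      have e2 : ∫ x in Ioo 0 L, w x * ψ x = m * c := by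
        have : ∀ x, w x * (ψ x - m * χ x) = w x * ψ x - m * (w x * χ x) := fun x => by ring
        simp only [this] at h1
        rw [integral_sub (hmul ψ hψ.continuous hψc) ((hmul χ hχ.continuous hχc).const_mul m),
          integral_const_mul] at h1
        linarith
      have : ∀ x, ψ x • (w x - c) = w x * ψ x - c * ψ x := fun x => by
        rw [smul_eq_mul]; ring
      simp only [this]
      rw [integral_sub (hmul ψ hψ.continuous hψc) (hψi.integrableOn.const_mul c),
        integral_const_mul, e1, e2]
      ring
  filter_upwards [key] with x hx hxL
  linarith [hx hxL]

/-- A function in `H¹(0, L)` is almost everywhere a primitive of its weak derivative. -/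
lemma IsH1With.exists_ae_eq_primitive {L : ℝ} (hL : 0 < L) {f f' : ℝ → ℝ} (h : IsH1With L f f') :
    ∃ c, ∀ᵐ x, x ∈ Ioo 0 L → f x = c + ∫ y in (0 : ℝ)..x, f' y := by
  have hint : ∀ q, MemL2 L q → IntegrableOn q (Ioo 0 L) := fun q hq =>
    MemLp.integrable (by norm_num) hq
  have hf' : IntervalIntegrable f' volume 0 L := by
    rw [intervalIntegrable_iff_integrableOn_Ioo_of_le hL.le]
    exact hint _ h.2.1
  have hac := hf'.absolutelyContinuousOnInterval_intervalIntegral (c := 0) (by simp)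
  have hcont : ContinuousOn (fun x => ∫ y in (0 : ℝ)..x, f' y) (Icc 0 L) := by
    simpa [uIcc_of_le hL.le] using hac.continuousOn
  have hPi : IntegrableOn (fun x => ∫ y in (0 : ℝ)..x, f' y) (Ioo 0 L) :=
    (hcont.integrableOn_Icc).mono_set Ioo_subset_Icc_self
  refine (ae_eq_const_of_integral_mul_deriv hL
    (w := fun x => f x - ∫ y in (0 : ℝ)..x, f' y) ((hint _ h.1).sub hPi) ?_).imp fun c hc => ?_
  rotate_left
  · filter_upwards [hc] with x hx hxL
    linarith [hx hxL]
  · intro φ ψ hφ hφc hφs hd hψ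
    have h1 := h.2.2.2.2 φ hφ hφc hφs
    have e1 : ∀ x, fderiv ℝ φ x 1 = ψ x := fun x => by
      rw [fderiv_apply_one_eq_deriv, (hd x).deriv]
    simp only [e1] at h1
    have hφ0 : ∀ x, x ∉ Ioo 0 L → φ x = 0 := fun x hx =>
      image_eq_zero_of_notMem_tsupport fun hx' => hx (hφs hx')
    -- The primitive of `f'` also has weak derivative `f'`, so its difference from `f` is orthogonal
    -- to derivatives of test functions.
    have h2 := integral_mul_eq_of_eq_primitive hL.le hf' (hψ.intervalIntegrable 0 L)
      (A := fun x => ∫ y in (0 : ℝ)..x, f' y) (B := φ) (fun t _ => by simp)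
      (fun t _ => by
        rw [intervalIntegral.integral_eq_sub_of_hasDerivAt (fun x _ => hd x)
          (hψ.intervalIntegrable _ _)]
        ring)
    rw [hφ0 L (by simp), hφ0 0 (by simp), intervalIntegral_eq_integral_Ioo hL.le,
      intervalIntegral_eq_integral_Ioo hL.le (f := fun t => f' t * φ t)] at h2
    have hψb : HasCompactSupport ψ := by
      rw [show ψ = deriv φ from funext fun x => (hd x).deriv.symm]
      exact hφc.deriv
    obtain ⟨C, hC⟩ := hψb.exists_bound_of_continuous hψ
    simp only [sub_mul]
    rw [integral_sub ((hint _ h.1).mul_bdd hψ.aestronglyMeasurable (Eventually.of_forall hC))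
      (hPi.mul_bdd hψ.aestronglyMeasurable (Eventually.of_forall hC)), h1, h2]
    ring

/-! ### Duhamel's formula for the wave equation on the line -/

/-- The solution of `u_tt = u_xx + f` with zero initial data. -/
noncomputable def duhamel (f : ℝ × ℝ → ℝ) (t x : ℝ) : ℝ :=
  2⁻¹ * ∫ s in (0 : ℝ)..t, ∫ y in (x - (t - s))..(x + (t - s)), f (s, y)

/-- The integral of `f` along the characteristic `x + s = a`. -/
noncomputable def charPlus (f : ℝ × ℝ → ℝ) (t a : ℝ) : ℝ := ∫ s in (0 : ℝ)..t, f (s, a - s)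

/-- The integral of `f` along the characteristic `x - s = b`. -/
noncomputable def charMinus (f : ℝ × ℝ → ℝ) (t b : ℝ) : ℝ := ∫ s in (0 : ℝ)..t, f (s, b + s)

section Bounded

variable {f : ℝ × ℝ → ℝ} {M : ℝ}

lemma abs_charPlus_le (hM : ∀ z, |f z| ≤ M) (t a : ℝ) : |charPlus f t a| ≤ M * |t| := by
  simpa [charPlus] using abs_intervalIntegral_le (fun s => hM (s, a - s)) 0 t

lemma abs_charMinus_le (hM : ∀ z, |f z| ≤ M) (t b : ℝ) : |charMinus f t b| ≤ M * |t| := by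
  simpa [charMinus] using abs_intervalIntegral_le (fun s => hM (s, b + s)) 0 t

lemma measurable_charPlus (hf : Measurable f) :
    Measurable fun z : ℝ × ℝ => charPlus f z.1 z.2 :=
  measurable_intervalIntegral (h := fun (z : ℝ × ℝ) s => f (s, z.2 - s))
    (hf.comp (by fun_prop)) measurable_const measurable_fst

lemma measurable_charMinus (hf : Measurable f) :
    Measurable fun z : ℝ × ℝ => charMinus f z.1 z.2 :=
  measurable_intervalIntegral (h := fun (z : ℝ × ℝ) s => f (s, z.2 + s))
    (hf.comp (by fun_prop)) measurable_const measurable_fst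

lemma charMinus_eq_charPlus (he : ∀ s y, f (s, -y) = f (s, y)) (t b : ℝ) :
    charMinus f t b = charPlus f t (-b) := by
  unfold charMinus charPlus
  congr 1
  funext s
  rw [← he]
  ring_nf

lemma charPlus_periodic {P : ℝ} (hp : ∀ s y, f (s, y + P) = f (s, y)) (t a : ℝ) :
    charPlus f t (a + P) = charPlus f t a := by
  unfold charPlus
  congr 1
  funext s
  rw [← hp s (a - s)]
  ring_nf

lemma duhamel_zero (f : ℝ × ℝ → ℝ) (x : ℝ) : duhamel f 0 x = 0 := by simp [duhamel]

lemma duhamel_neg (he : ∀ s y, f (s, -y) = f (s, y)) (t x : ℝ) :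
    duhamel f t (-x) = duhamel f t x := by
  unfold duhamel
  congr 2
  funext s
  have h := intervalIntegral.integral_comp_neg (fun y => f (s, y))
    (a := x - (t - s)) (b := x + (t - s))
  simp only [he] at h
  rw [h]
  ring_nf

lemma duhamel_periodic {P : ℝ} (hp : ∀ s y, f (s, y + P) = f (s, y)) (t x : ℝ) :
    duhamel f t (x + P) = duhamel f t x := by
  unfold duhamel
  congr 2
  funext s
  have h := intervalIntegral.integral_comp_add_right (fun y => f (s, y)) P
    (a := x - (t - s)) (b := x + (t - s))
  simp only [hp] at h
  rw [h]
  ring_nf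

/-- Causality: this is what makes the iteration for the delayed problem stabilise. -/
lemma duhamel_congr {g : ℝ × ℝ → ℝ} {t : ℝ} (ht : 0 ≤ t)
    (h : ∀ s ∈ Ioc 0 t, ∀ y, f (s, y) = g (s, y)) (x : ℝ) : duhamel f t x = duhamel g t x := by
  unfold duhamel
  rw [intervalIntegral.integral_of_le ht, intervalIntegral.integral_of_le ht]
  congr 1
  refine setIntegral_congr_fun measurableSet_Ioc fun s hs => ?_
  simp only [h s hs]

/-- The backward characteristic triangle with apex `(t, x)`. -/
def triangle (t x : ℝ) : Set (ℝ × ℝ) :=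
  {z | z.1 ∈ Ioc 0 t ∧ z.2 ∈ Ioc (x - (t - z.1)) (x + (t - z.1))}

lemma measurableSet_triangle (t x : ℝ) : MeasurableSet (triangle t x) := by
  unfold triangle
  refine (measurable_fst measurableSet_Ioc).inter ?_
  have h1 : MeasurableSet {z : ℝ × ℝ | x - (t - z.1) < z.2} :=
    measurableSet_lt (by fun_prop) (by fun_prop)
  have h2 : MeasurableSet {z : ℝ × ℝ | z.2 ≤ x + (t - z.1)} :=
    measurableSet_le (by fun_prop) (by fun_prop)
  exact h1.inter h2

lemma isBounded_triangle (t x : ℝ) : Bornology.IsBounded (triangle t x) := by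
  refine ((Metric.isBounded_Icc (0 : ℝ) t).prod (Metric.isBounded_Icc (x - t) (x + t))).subset ?_
  rintro ⟨s, y⟩ ⟨⟨h1, h2⟩, h3, h4⟩
  simp only at h1 h2 h3 h4
  exact ⟨⟨h1.le, h2⟩, by simp only; linarith, by simp only; linarith⟩

/-- In this form the Duhamel term is visibly continuous under weak convergence of the source and
blind to changes of the source on null sets. -/
lemma duhamel_eq_setIntegral (hf : Measurable f) (hM : ∀ z, |f z| ≤ M) {t : ℝ} (ht : 0 ≤ t)
    (x : ℝ) : duhamel f t x = 2⁻¹ * ∫ z in triangle t x, f z := by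
  have hA := measurableSet_triangle t x
  have hi : Integrable ((triangle t x).indicator f) (volume.prod volume) := by
    rw [← Measure.volume_eq_prod, integrable_indicator_iff hA]
    exact integrableOn_of_abs_le hf hM (isBounded_triangle t x).measure_lt_top.ne
  rw [← integral_indicator hA, Measure.volume_eq_prod, integral_prod _ hi, duhamel,
    intervalIntegral.integral_of_le ht, ← integral_indicator measurableSet_Ioc]
  congr 2
  funext s
  by_cases hs : s ∈ Ioc 0 t
  · rw [indicator_of_mem hs, intervalIntegral.integral_of_le (by linarith [hs.2]),
      ← integral_indicator measurableSet_Ioc]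
    congr 1
    funext y
    by_cases hy : y ∈ Ioc (x - (t - s)) (x + (t - s))
    · rw [indicator_of_mem hy, indicator_of_mem (show (s, y) ∈ triangle t x from ⟨hs, hy⟩)]
    · rw [indicator_of_notMem hy, indicator_of_notMem fun h => hy h.2]
  · rw [indicator_of_notMem hs]
    have : ∀ y, (triangle t x).indicator f (s, y) = 0 := fun y =>
      indicator_of_notMem (fun h => hs h.1) _
    simp [this]

lemma intervalIntegrable_slice (hf : Measurable f) (hM : ∀ z, |f z| ≤ M) (s a b : ℝ) :
    IntervalIntegrable (fun y => f (s, y)) volume a b :=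
  intervalIntegrable_of_abs_le (hf.comp measurable_prodMk_left) (fun y => hM (s, y)) a b

lemma measurable_primitive_slice (hf : Measurable f) {a b : ℝ → ℝ} (ha : Measurable a)
    (hb : Measurable b) : Measurable fun s => ∫ y in (a s)..(b s), f (s, y) :=
  measurable_intervalIntegral (h := fun s y => f (s, y)) hf ha hb

lemma intervalIntegrable_primitive_slice (hf : Measurable f) (hM : ∀ z, |f z| ≤ M) {a b : ℝ → ℝ}
    (ha : Continuous a) (hb : Continuous b) (c d : ℝ) :
    IntervalIntegrable (fun s => ∫ y in (a s)..(b s), f (s, y)) volume c d := by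
  have hg : IntervalIntegrable (fun s => M * |b s - a s|) volume c d :=
    (by fun_prop : Continuous fun s => M * |b s - a s|).intervalIntegrable c d
  exact hg.mono_fun' (measurable_primitive_slice hf ha.measurable hb.measurable).aestronglyMeasurable
    (Eventually.of_forall fun s => abs_intervalIntegral_le (fun y => hM (s, y)) _ _)

lemma intervalIntegrable_charPlus_time (hf : Measurable f) (hM : ∀ z, |f z| ≤ M) (x a b : ℝ) :
    IntervalIntegrable (fun t => charPlus f t (x + t)) volume a b := by
  have hg : IntervalIntegrable (fun t : ℝ => M * |t|) volume a b :=
    (by fun_prop : Continuous fun t : ℝ => M * |t|).intervalIntegrable a b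
  exact hg.mono_fun' ((measurable_charPlus hf).comp (by fun_prop : Measurable
    fun t : ℝ => (t, x + t))).aestronglyMeasurable
    (Eventually.of_forall fun t => abs_charPlus_le hM _ _)

lemma intervalIntegrable_charMinus_time (hf : Measurable f) (hM : ∀ z, |f z| ≤ M) (x a b : ℝ) :
    IntervalIntegrable (fun t => charMinus f t (x - t)) volume a b := by
  have hg : IntervalIntegrable (fun t : ℝ => M * |t|) volume a b :=
    (by fun_prop : Continuous fun t : ℝ => M * |t|).intervalIntegrable a b
  exact hg.mono_fun' ((measurable_charMinus hf).comp (by fun_prop : Measurable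
    fun t : ℝ => (t, x - t))).aestronglyMeasurable
    (Eventually.of_forall fun t => abs_charMinus_le hM _ _)

lemma intervalIntegrable_charPlus_space (hf : Measurable f) (hM : ∀ z, |f z| ≤ M) (t a b : ℝ) :
    IntervalIntegrable (fun y => charPlus f t (y + t)) volume a b :=
  intervalIntegrable_of_abs_le ((measurable_charPlus hf).comp (by fun_prop : Measurable
    fun y : ℝ => (t, y + t))) (fun y => abs_charPlus_le hM t _) a b

lemma intervalIntegrable_charMinus_space (hf : Measurable f) (hM : ∀ z, |f z| ≤ M) (t a b : ℝ) :
    IntervalIntegrable (fun y => charMinus f t (y - t)) volume a b :=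
  intervalIntegrable_of_abs_le ((measurable_charMinus hf).comp (by fun_prop : Measurable
    fun y : ℝ => (t, y - t))) (fun y => abs_charMinus_le hM t _) a b

/-- After exchanging the integrals over `s ≤ t`, the two characteristic terms sweep the right and
the left half of the base interval at height `s`. This exhibits the time derivative for a source
that is merely bounded and measurable. -/
lemma duhamel_eq_integral_time (hf : Measurable f) (hM : ∀ z, |f z| ≤ M) {T : ℝ} (hT : 0 ≤ T)
    (x : ℝ) : duhamel f T x =
      2⁻¹ * ∫ t in (0 : ℝ)..T, (charPlus f t (x + t) + charMinus f t (x - t)) := by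
  rw [intervalIntegral.integral_add (intervalIntegrable_charPlus_time hf hM _ _ _)
    (intervalIntegrable_charMinus_time hf hM _ _ _)]
  unfold charPlus charMinus
  rw [intervalIntegral_swap_triangle (h := fun s t => f (s, x + t - s)) (hf.comp (by fun_prop))
    (fun s t => hM _) hT, intervalIntegral_swap_triangle (h := fun s t => f (s, x - t + s))
    (hf.comp (by fun_prop)) (fun s t => hM _) hT]
  have e1 : ∀ s, ∫ t in s..T, f (s, x + t - s) = ∫ y in x..(x + (T - s)), f (s, y) := by
    intro s
    have := intervalIntegral.integral_comp_add_right (fun y => f (s, y)) (x - s) (a := s) (b := T)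
    rw [show s + (x - s) = x by ring, show T + (x - s) = x + (T - s) by ring] at this
    rw [← this]
    refine intervalIntegral.integral_congr fun t _ => ?_
    ring_nf
  have e2 : ∀ s, ∫ t in s..T, f (s, x - t + s) = ∫ y in (x - (T - s))..x, f (s, y) := by
    intro s
    have := intervalIntegral.integral_comp_sub_left (fun y => f (s, y)) (x + s) (a := s) (b := T)
    rw [show x + s - s = x by ring, show x + s - T = x - (T - s) by ring] at this
    rw [← this]
    refine intervalIntegral.integral_congr fun t _ => ?_
    ring_nf
  simp only [e1, e2]
  rw [← intervalIntegral.integral_add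
    (intervalIntegrable_primitive_slice hf hM (by fun_prop) (by fun_prop) _ _)
    (intervalIntegrable_primitive_slice hf hM (by fun_prop) (by fun_prop) _ _), duhamel]
  congr 1
  refine intervalIntegral.integral_congr fun s _ => ?_
  exact (intervalIntegral.integral_add_adjacent_intervals
    (intervalIntegrable_slice hf hM _ _ _) (intervalIntegrable_slice hf hM _ _ _)).symm.trans
    (add_comm _ _)

/-- Translating the base interval at height `s` gains mass at its right end and loses it at its left
end; integrated in `s`, these ends are the two characteristics through the apex. -/
lemma duhamel_sub_eq_integral_space (hf : Measurable f) (hM : ∀ z, |f z| ≤ M) (t x₀ x : ℝ) :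
    duhamel f t x - duhamel f t x₀ =
      2⁻¹ * ∫ y in x₀..x, (charPlus f t (y + t) - charMinus f t (y - t)) := by
  rw [intervalIntegral.integral_sub (intervalIntegrable_charPlus_space hf hM _ _ _)
    (intervalIntegrable_charMinus_space hf hM _ _ _)]
  unfold charPlus charMinus
  rw [intervalIntegral_swap_of_abs_le (h := fun y s => f (s, y + t - s)) (hf.comp (by fun_prop))
    (fun s t => hM _), intervalIntegral_swap_of_abs_le (h := fun y s => f (s, y - t + s))
    (hf.comp (by fun_prop)) (fun s t => hM _)]
  have e1 : ∀ s, ∫ y in x₀..x, f (s, y + t - s) = ∫ y in (x₀ + (t - s))..(x + (t - s)), f (s, y) := by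
    intro s
    rw [← intervalIntegral.integral_comp_add_right (fun y => f (s, y))]
    refine intervalIntegral.integral_congr fun t _ => ?_
    ring_nf
  have e2 : ∀ s, ∫ y in x₀..x, f (s, y - t + s) = ∫ y in (x₀ - (t - s))..(x - (t - s)), f (s, y) := by
    intro s
    rw [← intervalIntegral.integral_comp_sub_right (fun y => f (s, y))]
    refine intervalIntegral.integral_congr fun t _ => ?_
    ring_nf
  simp only [e1, e2]
  unfold duhamel
  rw [← mul_sub, ← intervalIntegral.integral_sub
    (intervalIntegrable_primitive_slice hf hM (by fun_prop) (by fun_prop) _ _)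
    (intervalIntegrable_primitive_slice hf hM (by fun_prop) (by fun_prop) _ _),
    ← intervalIntegral.integral_sub
    (intervalIntegrable_primitive_slice hf hM (by fun_prop) (by fun_prop) _ _)
    (intervalIntegrable_primitive_slice hf hM (by fun_prop) (by fun_prop) _ _)]
  congr 1
  refine intervalIntegral.integral_congr fun s _ => ?_
  have hI := fun a b => intervalIntegrable_slice hf hM s a b
  rw [intervalIntegral.integral_interval_sub_interval_comm (hI _ _) (hI _ _) (hI _ _),
    intervalIntegral.integral_symm (x₀ - (t - s)) (x - (t - s)),
    intervalIntegral.integral_symm (x₀ + (t - s)) (x + (t - s))]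
  ring

/-- Each derivative is half of a sum or difference of two characteristic integrals, each at most `M
T`. The constant depends on the source only through `M`, which gives equicontinuity of the
approximations. -/
lemma abs_duhamel_sub_le (hf : Measurable f) (hM : ∀ z, |f z| ≤ M) {T t t' : ℝ} (ht : t ∈ Icc 0 T)
    (ht' : t' ∈ Icc 0 T) (x x' : ℝ) :
    |duhamel f t x - duhamel f t' x'| ≤ M * T * (|t - t'| + |x - x'|) := by
  have hM0 : 0 ≤ M := (abs_nonneg _).trans (hM 0)
  have hT : 0 ≤ T := ht.1.trans ht.2
  have h1 : |duhamel f t x - duhamel f t' x| ≤ M * T * |t - t'| := by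
    have hi : ∀ a b, IntervalIntegrable
        (fun t => charPlus f t (x + t) + charMinus f t (x - t)) volume a b := fun a b =>
      (intervalIntegrable_charPlus_time hf hM _ _ _).add
        (intervalIntegrable_charMinus_time hf hM _ _ _)
    rw [duhamel_eq_integral_time hf hM ht.1, duhamel_eq_integral_time hf hM ht'.1, ← mul_sub,
      intervalIntegral.integral_interval_sub_left (hi _ _) (hi _ _), abs_mul,
      abs_of_pos (by norm_num : (0 : ℝ) < 2⁻¹)]
    have : |∫ s in t'..t, (charPlus f s (x + s) + charMinus f s (x - s))| ≤ 2 * M * T * |t - t'| := by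
      rw [← Real.norm_eq_abs]
      refine intervalIntegral.norm_integral_le_of_norm_le_const fun s hs => ?_
      have hs' : |s| ≤ T := by
        rw [mem_uIoc] at hs
        rw [abs_le]
        constructor <;> rcases hs with hs | hs <;> linarith [ht.1, ht.2, ht'.1, ht'.2]
      have ha := abs_charPlus_le hM s (x + s)
      have hb := abs_charMinus_le hM s (x - s)
      have hc := mul_le_mul_of_nonneg_left hs' hM0
      calc ‖charPlus f s (x + s) + charMinus f s (x - s)‖
          ≤ |charPlus f s (x + s)| + |charMinus f s (x - s)| := abs_add_le _ _
        _ ≤ 2 * M * T := by linarith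
    linarith
  have h2 : |duhamel f t' x - duhamel f t' x'| ≤ M * T * |x - x'| := by
    rw [duhamel_sub_eq_integral_space hf hM, abs_mul, abs_of_pos (by norm_num : (0 : ℝ) < 2⁻¹)]
    have : |∫ y in x'..x, (charPlus f t' (y + t') - charMinus f t' (y - t'))|
        ≤ 2 * M * T * |x - x'| := by
      refine abs_intervalIntegral_le (fun y => ?_) _ _
      have hs' : |t'| ≤ T := by rw [abs_of_nonneg ht'.1]; exact ht'.2
      have ha := abs_charPlus_le hM t' (y + t')
      have hb := abs_charMinus_le hM t' (y - t')
      have hc := mul_le_mul_of_nonneg_left hs' hM0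
      calc |charPlus f t' (y + t') - charMinus f t' (y - t')|
          ≤ |charPlus f t' (y + t')| + |charMinus f t' (y - t')| := abs_sub _ _
        _ ≤ 2 * M * T := by linarith
    linarith
  calc |duhamel f t x - duhamel f t' x'|
      ≤ |duhamel f t x - duhamel f t' x| + |duhamel f t' x - duhamel f t' x'| :=
        abs_sub_le _ _ _
    _ ≤ M * T * (|t - t'| + |x - x'|) := by rw [mul_add]; exact add_le_add h1 h2

lemma continuous_duhamel (hf : Measurable f) (hM : ∀ z, |f z| ≤ M) :
    Continuous fun z : ℝ × ℝ => duhamel f (max z.1 0) z.2 := by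
  rw [continuous_iff_continuousAt]
  rintro ⟨t₀, x₀⟩
  set T := |t₀| + 1
  have hT : 0 ≤ T := by positivity
  have hlim : Tendsto (fun z : ℝ × ℝ => M * T * (|max z.1 0 - max t₀ 0| + |z.2 - x₀|))
      (𝓝 (t₀, x₀)) (𝓝 0) := by
    have : Continuous fun z : ℝ × ℝ => M * T * (|max z.1 0 - max t₀ 0| + |z.2 - x₀|) := by
      fun_prop
    simpa using this.tendsto (t₀, x₀)
  rw [ContinuousAt, tendsto_iff_dist_tendsto_zero]
  refine squeeze_zero' (Eventually.of_forall fun _ => dist_nonneg) ?_ hlim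
  have hev : ∀ᶠ z : ℝ × ℝ in 𝓝 (t₀, x₀), z.1 < T :=
    continuous_fst.continuousAt.eventually_lt continuousAt_const
      (show t₀ < T by linarith [le_abs_self t₀])
  filter_upwards [hev] with z hz
  exact abs_duhamel_sub_le hf hM ⟨le_max_right _ _, max_le hz.le hT⟩
    ⟨le_max_right _ _, max_le (by linarith [le_abs_self t₀]) hT⟩ _ _

end Bounded

/-! ### Solutions of the inhomogeneous wave equation -/

/-- The solution of `u_tt = u_xx` with `u(0, x) = c + ∫_{-x}^x p` and `u_t + u_x = 2 p` at time `0`,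
even in `x`. -/
noncomputable def freeWave (c : ℝ) (p : ℝ → ℝ) (t x : ℝ) : ℝ :=
  c + (∫ y in (0 : ℝ)..(x + t), p y) + ∫ y in (0 : ℝ)..(t - x), p y

/-- The quantity `(u_t + u_x) / 2` on the characteristic `x + t = a`. -/
noncomputable def speedPlus (p : ℝ → ℝ) (f : ℝ × ℝ → ℝ) (t a : ℝ) : ℝ :=
  p a + 2⁻¹ * charPlus f t a

/-- The quantity `(u_t - u_x) / 2` on the characteristic `x - t = b`. -/
noncomputable def speedMinus (p : ℝ → ℝ) (f : ℝ × ℝ → ℝ) (t b : ℝ) : ℝ :=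
  p (-b) + 2⁻¹ * charMinus f t b

lemma freeWave_neg (c : ℝ) (p : ℝ → ℝ) (t x : ℝ) : freeWave c p t (-x) = freeWave c p t x := by
  unfold freeWave
  rw [sub_neg_eq_add, show -x + t = t - x by ring, show t + x = x + t by ring]
  ring

section Wave

variable {c M : ℝ} {p : ℝ → ℝ} {f : ℝ × ℝ → ℝ}

/-- A shift by a period adds the integral of `p` over one period to the first term and removes it
from the second, so `p` need not have mean zero. -/
lemma freeWave_periodic (hpi : ∀ a b, IntervalIntegrable p volume a b) {P : ℝ}
    (hp : Function.Periodic p P) (t x : ℝ) : freeWave c p t (x + P) = freeWave c p t x := by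
  unfold freeWave
  have h1 : ∫ y in (0 : ℝ)..(x + P + t), p y
      = (∫ y in (0 : ℝ)..(x + t), p y) + ∫ y in (x + t)..(x + t + P), p y := by
    rw [intervalIntegral.integral_add_adjacent_intervals (hpi _ _) (hpi _ _)]
    ring_nf
  have h2 : ∫ y in (0 : ℝ)..(t - x), p y
      = (∫ y in (0 : ℝ)..(t - (x + P)), p y)
        + ∫ y in (t - (x + P))..(t - (x + P) + P), p y := by
    rw [intervalIntegral.integral_add_adjacent_intervals (hpi _ _) (hpi _ _)]
    ring_nf
  rw [h1, h2, hp.intervalIntegral_add_eq (x + t) (t - (x + P))]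
  ring

lemma continuous_freeWave (hpi : ∀ a b, IntervalIntegrable p volume a b) :
    Continuous fun z : ℝ × ℝ => freeWave c p z.1 z.2 := by
  have h := intervalIntegral.continuous_primitive hpi 0
  unfold freeWave
  exact (continuous_const.add (h.comp (by fun_prop : Continuous fun z : ℝ × ℝ => z.2 + z.1))).add
    (h.comp (by fun_prop : Continuous fun z : ℝ × ℝ => z.1 - z.2))

lemma measurable_speedPlus (hpm : Measurable p) (hf : Measurable f) :
    Measurable fun z : ℝ × ℝ => speedPlus p f z.1 z.2 :=
  (hpm.comp measurable_snd).add ((measurable_charPlus hf).const_mul _)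

lemma measurable_speedMinus (hpm : Measurable p) (hf : Measurable f) :
    Measurable fun z : ℝ × ℝ => speedMinus p f z.1 z.2 :=
  (hpm.comp measurable_snd.neg).add ((measurable_charMinus hf).const_mul _)

lemma intervalIntegrable_comp_add (hpi : ∀ a b, IntervalIntegrable p volume a b) (x a b : ℝ) :
    IntervalIntegrable (fun t => p (x + t)) volume a b := by
  simpa using (hpi (x + a) (x + b)).comp_add_left x

lemma intervalIntegrable_comp_sub (hpi : ∀ a b, IntervalIntegrable p volume a b) (x a b : ℝ) :
    IntervalIntegrable (fun t => p (x - t)) volume a b := by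
  simpa using (hpi (x - a) (x - b)).comp_sub_left x

lemma intervalIntegrable_speedPlus_time (hpi : ∀ a b, IntervalIntegrable p volume a b)
    (hf : Measurable f) (hM : ∀ z, |f z| ≤ M) (x a b : ℝ) :
    IntervalIntegrable (fun t => speedPlus p f t (x + t)) volume a b :=
  (intervalIntegrable_comp_add hpi x a b).add
    ((intervalIntegrable_charPlus_time hf hM x a b).const_mul _)

lemma intervalIntegrable_speedMinus_time (hpi : ∀ a b, IntervalIntegrable p volume a b)
    (hf : Measurable f) (hM : ∀ z, |f z| ≤ M) (x a b : ℝ) :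
    IntervalIntegrable (fun t => speedMinus p f t (x - t)) volume a b := by
  refine IntervalIntegrable.add ?_ ((intervalIntegrable_charMinus_time hf hM x a b).const_mul _)
  have := intervalIntegrable_comp_add hpi (-x) a b
  exact this.congr fun t _ => by rw [neg_sub, neg_add_eq_sub]

lemma intervalIntegrable_speedPlus_space (hpi : ∀ a b, IntervalIntegrable p volume a b)
    (hf : Measurable f) (hM : ∀ z, |f z| ≤ M) (t a b : ℝ) :
    IntervalIntegrable (fun y => speedPlus p f t (y + t)) volume a b := by
  refine IntervalIntegrable.add ?_ ((intervalIntegrable_charPlus_space hf hM t a b).const_mul _)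
  simpa only [add_comm] using intervalIntegrable_comp_add hpi t a b

lemma intervalIntegrable_speedMinus_space (hpi : ∀ a b, IntervalIntegrable p volume a b)
    (hf : Measurable f) (hM : ∀ z, |f z| ≤ M) (t a b : ℝ) :
    IntervalIntegrable (fun y => speedMinus p f t (y - t)) volume a b := by
  refine IntervalIntegrable.add ?_ ((intervalIntegrable_charMinus_space hf hM t a b).const_mul _)
  simpa only [neg_sub] using intervalIntegrable_comp_sub hpi t a b

/-- This and the spatial formula after it identify `u_t` and `u_x` as sum and difference of the two
transported quantities, on every vertical and every horizontal line. -/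
lemma wave_eq_integral_time (hpi : ∀ a b, IntervalIntegrable p volume a b)
    (hf : Measurable f) (hM : ∀ z, |f z| ≤ M) {T : ℝ} (hT : 0 ≤ T) (x : ℝ) :
    freeWave c p T x + duhamel f T x = freeWave c p 0 x + duhamel f 0 x +
      ∫ t in (0 : ℝ)..T, (speedPlus p f t (x + t) + speedMinus p f t (x - t)) := by
  have e : ∀ t, speedPlus p f t (x + t) + speedMinus p f t (x - t) =
      (p (x + t) + p (-x + t)) + 2⁻¹ * (charPlus f t (x + t) + charMinus f t (x - t)) := by
    intro t
    unfold speedPlus speedMinus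
    rw [show -(x - t) = -x + t by ring]
    ring
  simp only [e]
  rw [intervalIntegral.integral_add
    ((intervalIntegrable_comp_add hpi x 0 T).add (intervalIntegrable_comp_add hpi (-x) 0 T))
    (((intervalIntegrable_charPlus_time hf hM x 0 T).add
      (intervalIntegrable_charMinus_time hf hM x 0 T)).const_mul _),
    intervalIntegral.integral_const_mul, ← duhamel_eq_integral_time hf hM hT, duhamel_zero,
    intervalIntegral.integral_add (intervalIntegrable_comp_add hpi x 0 T)
      (intervalIntegrable_comp_add hpi (-x) 0 T),
    intervalIntegral.integral_comp_add_left, intervalIntegral.integral_comp_add_left]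
  unfold freeWave
  rw [← intervalIntegral.integral_add_adjacent_intervals (hpi 0 (x + 0)) (hpi (x + 0) (x + T)),
    show T - x = -x + T by ring, show 0 - x = -x + 0 by ring,
    ← intervalIntegral.integral_add_adjacent_intervals (hpi 0 (-x + 0)) (hpi (-x + 0) (-x + T))]
  ring

lemma wave_eq_integral_space (hpi : ∀ a b, IntervalIntegrable p volume a b)
    (hf : Measurable f) (hM : ∀ z, |f z| ≤ M) (t x : ℝ) :
    freeWave c p t x + duhamel f t x = freeWave c p t 0 + duhamel f t 0 +
      ∫ y in (0 : ℝ)..x, (speedPlus p f t (y + t) - speedMinus p f t (y - t)) := by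
  have e : ∀ y, speedPlus p f t (y + t) - speedMinus p f t (y - t) =
      (p (t + y) - p (t - y)) + 2⁻¹ * (charPlus f t (y + t) - charMinus f t (y - t)) := by
    intro y
    unfold speedPlus speedMinus
    rw [show -(y - t) = t - y by ring, show y + t = t + y by ring]
    ring
  simp only [e]
  rw [intervalIntegral.integral_add
    ((intervalIntegrable_comp_add hpi t 0 x).sub (intervalIntegrable_comp_sub hpi t 0 x))
    (((intervalIntegrable_charPlus_space hf hM t 0 x).sub
      (intervalIntegrable_charMinus_space hf hM t 0 x)).const_mul _),
    intervalIntegral.integral_const_mul, ← duhamel_sub_eq_integral_space hf hM,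
    intervalIntegral.integral_sub (intervalIntegrable_comp_add hpi t 0 x)
      (intervalIntegrable_comp_sub hpi t 0 x),
    intervalIntegral.integral_comp_add_left, intervalIntegral.integral_comp_sub_left]
  unfold freeWave
  rw [show x + t = t + x by ring, show 0 + t = t + 0 by ring,
    ← intervalIntegral.integral_add_adjacent_intervals (hpi 0 (t + 0)) (hpi (t + 0) (t + x)),
    ← intervalIntegral.integral_add_adjacent_intervals (hpi 0 (t - x)) (hpi (t - x) (t - 0))]
  ring

lemma ae_hasDerivAt_primitive {g : ℝ → ℝ} (hg : ∀ a b, IntervalIntegrable g volume a b) :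
    ∀ᵐ x, HasDerivAt (fun x => ∫ y in (0 : ℝ)..x, g y) (g x) x := by
  have h : ∀ᵐ x, ∀ n : ℕ, x ∈ uIcc (-(n : ℝ)) n → ∀ c ∈ uIcc (-(n : ℝ)) n,
      HasDerivAt (fun x => ∫ y in c..x, g y) (g x) x :=
    ae_all_iff.2 fun n => (hg _ _).ae_hasDerivAt_integral
  filter_upwards [h] with x hx
  obtain ⟨n, hn⟩ := exists_nat_ge |x|
  have h0 : (0 : ℝ) ≤ n := n.cast_nonneg
  have hle : -(n : ℝ) ≤ n := by linarith
  rw [abs_le] at hn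
  exact hx n (by rw [uIcc_of_le hle]; exact hn) 0
    (by rw [uIcc_of_le hle]; exact ⟨by linarith, h0⟩)

lemma measurableSet_imp_eq {α : Type*} [MeasurableSpace α] {a b w : α → ℝ} {κ : ℝ}
    (ha : Measurable a) (hb : Measurable b) (hw : Measurable w) :
    MeasurableSet {z | 0 < a z → b z = κ → w z = 0} := by
  have h : {z | 0 < a z → b z = κ → w z = 0}
      = ({z | 0 < a z} ∩ {z | b z = κ})ᶜ ∪ {z | w z = 0} := by
    ext z
    simp only [mem_ofPred_eq, mem_union, mem_compl_iff, mem_inter_iff]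
    tauto
  rw [h]
  exact ((measurableSet_lt measurable_const ha).inter
    (measurableSet_eq_fun hb measurable_const)).compl.union
    (measurableSet_eq_fun hw measurable_const)

/-- The source of the wave equation vanishes almost everywhere on the level sets of the solution. -/
lemma ae_source_eq_zero_of_level (hpm : Measurable p)
    (hpi : ∀ a b, IntervalIntegrable p volume a b) (hf : Measurable f) (hM : ∀ z, |f z| ≤ M)
    {u : ℝ × ℝ → ℝ} (hu : Measurable u)
    (hw : ∀ t, 0 ≤ t → ∀ x, u (t, x) = freeWave c p t x + duhamel f t x) (κ : ℝ) :
    ∀ᵐ z, 0 < z.1 → u z = κ → f z = 0 := by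
  have hSP := measurable_speedPlus hpm hf
  have hSM := measurable_speedMinus hpm hf
  -- `u_t = 0` on the level set, proved on each line `x = const` and then rearranged by Fubini for
  -- null sets.
  have htime : ∀ᵐ t : ℝ, ∀ᵐ x : ℝ, 0 < t → u (t, x) = κ →
      speedPlus p f t (x + t) + speedMinus p f t (x - t) = 0 := by
    rw [Measure.ae_ae_comm (measurableSet_imp_eq measurable_fst hu
      ((hSP.comp (by fun_prop : Measurable fun z : ℝ × ℝ => (z.1, z.2 + z.1))).add
        (hSM.comp (by fun_prop : Measurable fun z : ℝ × ℝ => (z.1, z.2 - z.1)))))]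
    refine Eventually.of_forall fun x => ?_
    have hall : ∀ᵐ t : ℝ, ∀ n : ℕ, t ∈ Ioo (0 : ℝ) n → HasDerivAt (fun t => u (t, x))
        (speedPlus p f t (x + t) + speedMinus p f t (x - t)) t := by
      refine ae_all_iff.2 fun n => ae_hasDerivAt_of_eq_primitive n.cast_nonneg
        ((intervalIntegrable_speedPlus_time hpi hf hM x _ _).add
          (intervalIntegrable_speedMinus_time hpi hf hM x _ _)) fun t ht => ?_
      rw [hw t ht.1, hw 0 le_rfl, wave_eq_integral_time hpi hf hM ht.1]
    filter_upwards [hall, ae_deriv_eq_zero_of_level (fun t => u (t, x)) κ] with t h1 h2 ht hκ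
    obtain ⟨n, hn⟩ := exists_nat_gt t
    exact h2 _ hκ (h1 n ⟨ht, hn⟩)
  have hspace : ∀ᵐ t : ℝ, ∀ᵐ x : ℝ, 0 < t → u (t, x) = κ →
      speedPlus p f t (x + t) - speedMinus p f t (x - t) = 0 := by
    refine Eventually.of_forall fun t => ?_
    have hI : ∀ a b, IntervalIntegrable
        (fun y => speedPlus p f t (y + t) - speedMinus p f t (y - t)) volume a b := fun a b =>
      (intervalIntegrable_speedPlus_space hpi hf hM t a b).sub
        (intervalIntegrable_speedMinus_space hpi hf hM t a b)
    filter_upwards [ae_hasDerivAt_primitive hI, ae_deriv_eq_zero_of_level (fun x => u (t, x)) κ]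
      with x h1 h2 ht hκ
    refine h2 _ hκ ?_
    have h3 := h1.const_add (freeWave c p t 0 + duhamel f t 0)
    refine h3.congr_of_eventuallyEq (Eventually.of_forall fun y => ?_)
    exact (hw t ht.le y).trans (wave_eq_integral_space hpi hf hM t y)
  -- With `u_x = 0` as well, `(u_t + u_x) / 2` vanishes on the level set; the shear `a = x + t`
  -- turns this into a statement on almost every characteristic.
  have hchar : ∀ᵐ a : ℝ, ∀ᵐ t : ℝ, 0 < t → u (t, a - t) = κ → speedPlus p f t a = 0 := by
    rw [← Measure.ae_ae_comm (p := fun t a => 0 < t → u (t, a - t) = κ → speedPlus p f t a = 0)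
      (measurableSet_imp_eq measurable_fst
        (hu.comp (by fun_prop : Measurable fun z : ℝ × ℝ => (z.1, z.2 - z.1))) hSP)]
    filter_upwards [htime, hspace] with t h1 h2
    have h3 : ∀ᵐ x : ℝ, 0 < t → u (t, x) = κ → speedPlus p f t (x + t) = 0 := by
      filter_upwards [h1, h2] with x h1 h2 ht hκ
      linarith [h1 ht hκ, h2 ht hκ]
    have h4 := (measurePreserving_sub_right volume t).quasiMeasurePreserving.ae h3
    filter_upwards [h4] with a ha
    simpa using ha
  -- Second use of the level-set argument, now for the zero set of `speedPlus` in `t` at fixed `a`.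
  -- Its derivative is `f / 2`, so no second derivatives of `u` are needed.
  have hsource : ∀ᵐ a : ℝ, ∀ᵐ t : ℝ, 0 < t → u (t, a - t) = κ → f (t, a - t) = 0 := by
    filter_upwards [hchar] with a ha
    have hI : ∀ b d, IntervalIntegrable (fun s => f (s, a - s)) volume b d := fun b d =>
      intervalIntegrable_of_abs_le (hf.comp (by fun_prop)) (fun s => hM (s, a - s)) b d
    filter_upwards [ha, ae_hasDerivAt_primitive hI,
      ae_deriv_eq_zero_of_level (fun t => speedPlus p f t a) 0] with t h1 h2 h3 ht hκ
    have h4 := h3 _ (h1 ht hκ) ((h2.const_mul 2⁻¹).const_add (p a))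
    simpa using h4
  rw [Measure.volume_eq_prod, Measure.ae_prod_iff_ae_ae
    (measurableSet_imp_eq measurable_fst hu hf)]
  rw [← Measure.ae_ae_comm (p := fun t a => 0 < t → u (t, a - t) = κ → f (t, a - t) = 0)
    (measurableSet_imp_eq measurable_fst
      (hu.comp (by fun_prop : Measurable fun z : ℝ × ℝ => (z.1, z.2 - z.1)))
      (hf.comp (by fun_prop : Measurable fun z : ℝ × ℝ => (z.1, z.2 - z.1))))] at hsource
  filter_upwards [hsource] with t ht
  filter_upwards [(measurePreserving_add_right volume t).quasiMeasurePreserving.ae ht] with x hx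
  simpa using hx

end Wave

/-! ### The delayed problem -/

/-- Bounded measurable sources which are even and `P`-periodic in space. -/
structure IsSymmSource (P M : ℝ) (f : ℝ × ℝ → ℝ) : Prop where
  measurable : Measurable f
  abs_le : ∀ z, |f z| ≤ M
  even : ∀ s y, f (s, -y) = f (s, y)
  periodic : ∀ s y, f (s, y + P) = f (s, y)

/-- The source `-β(u)` evaluated with delay `δ`, where `u` is the solution with source `f`. -/
noncomputable def delayedSource (β : ℝ → ℝ) (D : ℝ × ℝ → ℝ) (δ : ℝ) (f : ℝ × ℝ → ℝ)
    (z : ℝ × ℝ) : ℝ :=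
  if δ < z.1 then -β (D (z.1 - δ, z.2) + duhamel f (max (z.1 - δ) 0) z.2) else 0

section Delay

variable {β : ℝ → ℝ} {D : ℝ × ℝ → ℝ} {P M δ : ℝ}

lemma IsSymmSource.delayedSource (hβ : Measurable β) (hM : ∀ s, |β s| ≤ M) (hD : Continuous D)
    (hDe : ∀ t x, D (t, -x) = D (t, x)) (hDp : ∀ t x, D (t, x + P) = D (t, x))
    {f : ℝ × ℝ → ℝ} (hf : IsSymmSource P M f) : IsSymmSource P M (delayedSource β D δ f) where
  measurable := by
    refine Measurable.ite (measurableSet_lt measurable_const measurable_fst) ?_ measurable_const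
    refine (hβ.comp (Continuous.measurable ?_)).neg
    exact (hD.comp (by fun_prop : Continuous fun z : ℝ × ℝ => (z.1 - δ, z.2))).add
      ((continuous_duhamel hf.measurable hf.abs_le).comp
        (by fun_prop : Continuous fun z : ℝ × ℝ => (z.1 - δ, z.2)))
  abs_le z := by
    unfold AdhesiveString.delayedSource
    split_ifs
    · rw [abs_neg]; exact hM _
    · rw [abs_zero]; exact (abs_nonneg _).trans (hM 0)
  even s y := by simp only [AdhesiveString.delayedSource, hDe, duhamel_neg hf.even]
  periodic s y := by simp only [AdhesiveString.delayedSource, hDp, duhamel_periodic hf.periodic]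

/-- The delayed source at time `s` depends only on the source up to time `s - δ`. Iterating from the
zero source therefore settles one more interval of length `δ` at each step, and finitely many steps
reach `T`. -/
lemma exists_delayed_solution (hβ : Measurable β) (hM : ∀ s, |β s| ≤ M) (hD : Continuous D)
    (hDe : ∀ t x, D (t, -x) = D (t, x)) (hDp : ∀ t x, D (t, x + P) = D (t, x)) (hδ : 0 < δ)
    (T : ℝ) : ∃ f, IsSymmSource P M f ∧ ∀ s, δ < s → s ≤ T → ∀ y,
      f (s, y) = -β (D (s - δ, y) + duhamel f (s - δ) y) := by
  set F : ℕ → ℝ × ℝ → ℝ := fun k => (delayedSource β D δ)^[k] fun _ => 0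
  have hsucc : ∀ k, F (k + 1) = delayedSource β D δ (F k) := fun k =>
    Function.iterate_succ_apply' _ _ _
  have hgood : ∀ k, IsSymmSource P M (F k) := by
    intro k
    induction k with
    | zero => exact ⟨measurable_const, fun z => by simpa [F] using (abs_nonneg _).trans (hM 0),
        fun _ _ => rfl, fun _ _ => rfl⟩
    | succ k ih => rw [hsucc]; exact ih.delayedSource hβ hM hD hDe hDp
  have hstab : ∀ k : ℕ, ∀ s, s ≤ (k + 1) * δ → ∀ y, F (k + 1) (s, y) = F k (s, y) := by
    intro k
    induction k with
    | zero =>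
      intro s hs y
      have : ¬ δ < s := by push_cast at hs; linarith
      simp [hsucc, delayedSource, this, F]
    | succ k ih =>
      intro s hs y
      rw [hsucc (k + 1)]
      conv_rhs => rw [hsucc k]
      unfold delayedSource
      by_cases h : δ < s
      · simp only [h, if_true]
        rw [duhamel_congr (g := F k) (le_max_right _ _) fun r hr y => ih r ?_ y]
        have h1 : r ≤ s - δ := by simpa [max_eq_left (sub_nonneg.2 h.le)] using hr.2
        push_cast at hs
        linarith
      · simp only [h, if_false]
  obtain ⟨k, hk⟩ := exists_nat_ge (T / δ)
  refine ⟨F k, hgood k, fun s hs hsT y => ?_⟩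
  have hkT : T ≤ k * δ := by rwa [div_le_iff₀ hδ] at hk
  rw [← hstab k s (by linarith) y, hsucc]
  simp only [delayedSource, hs, if_true, max_eq_left (sub_nonneg.2 hs.le)]

end Delay

/-! ### Mild solutions with a discontinuous nonlinearity -/

lemma tendsto_duhamel_of_weak {M : ℝ} {f : ℕ → ℝ × ℝ → ℝ} {g : ℝ × ℝ → ℝ}
    (hf : ∀ n, Measurable (f n)) (hM : ∀ n z, |f n z| ≤ M) (hg : Measurable g)
    (hgM : ∀ z, |g z| ≤ M) (h : ∀ A, MeasurableSet A → Bornology.IsBounded A →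
      Tendsto (fun n => ∫ z in A, f n z) atTop (𝓝 (∫ z in A, g z))) {t : ℝ} (ht : 0 ≤ t) (x : ℝ) :
    Tendsto (fun n => duhamel (f n) t x) atTop (𝓝 (duhamel g t x)) := by
  simp only [fun n => duhamel_eq_setIntegral (hf n) (hM n) ht x,
    duhamel_eq_setIntegral hg hgM ht x]
  exact (h _ (measurableSet_triangle t x) (isBounded_triangle t x)).const_mul _

/-- On a set of pointwise convergence, weak and pointwise limits agree. -/
lemma ae_eq_of_weak_of_pointwise {M : ℝ} {f : ℕ → ℝ × ℝ → ℝ} {g k : ℝ × ℝ → ℝ}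
    (hf : ∀ n, Measurable (f n)) (hM : ∀ n z, |f n z| ≤ M) (hg : Measurable g)
    (hgM : ∀ z, |g z| ≤ M) (h : ∀ A, MeasurableSet A → Bornology.IsBounded A →
      Tendsto (fun n => ∫ z in A, f n z) atTop (𝓝 (∫ z in A, g z)))
    (hk : Measurable k) (hkM : ∀ z, |k z| ≤ M) {S : Set (ℝ × ℝ)} (hS : MeasurableSet S)
    (hlim : ∀ z ∈ S, Tendsto (fun n => f n z) atTop (𝓝 (k z))) :
    ∀ᵐ z, z ∈ S → g z = k z := by
  have key : S.indicator (fun z => g z - k z) =ᵐ[volume] 0 := by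
    refine ae_eq_zero_of_forall_setIntegral_isCompact_eq_zero' ?_ fun s hs => ?_
    · have hb : ∀ z, |S.indicator (fun z => g z - k z) z| ≤ M + M := by
        intro z
        by_cases hz : z ∈ S
        · rw [indicator_of_mem hz]
          exact (abs_sub _ _).trans (add_le_add (hgM z) (hkM z))
        · rw [indicator_of_notMem hz, abs_zero]
          have := (abs_nonneg _).trans (hgM 0)
          linarith
      rw [locallyIntegrable_iff]
      exact fun K hK => integrableOn_of_abs_le ((hg.sub hk).indicator hS) hb hK.measure_lt_top.ne
    · have hsm := hs.measurableSet
      have hA : MeasurableSet (s ∩ S) := hsm.inter hS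
      have hAb : Bornology.IsBounded (s ∩ S) := hs.isBounded.subset inter_subset_left
      rw [setIntegral_indicator hS, integral_sub
        (integrableOn_of_abs_le hg hgM hAb.measure_lt_top.ne)
        (integrableOn_of_abs_le hk hkM hAb.measure_lt_top.ne), sub_eq_zero]
      refine tendsto_nhds_unique (h _ hA hAb) ?_
      refine tendsto_integral_of_dominated_convergence (fun _ => M)
        (fun n => (hf n).aestronglyMeasurable) ?_
        (fun n => Eventually.of_forall fun z => hM n z) ?_
      · exact integrableOn_const hAb.measure_lt_top.ne
      · exact (ae_restrict_iff' hA).2 (Eventually.of_forall fun z hz => hlim z hz.2)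
  filter_upwards [key] with z hz hzS
  rw [indicator_of_mem hzS] at hz
  exact sub_eq_zero.1 hz

/-- The delay is harmless because the Duhamel terms are Lipschitz in time on `[0, s]` with the
common constant `M s`. Continuity of `β` is needed only at the limiting value. -/
lemma tendsto_delayedSource {β : ℝ → ℝ} {D : ℝ × ℝ → ℝ} {P M s y l : ℝ} {f : ℕ → ℝ × ℝ → ℝ}
    {d : ℕ → ℝ} (hf : ∀ n, IsSymmSource P M (f n)) (hD : Continuous D)
    (hd : Tendsto d atTop (𝓝 0)) (hdpos : ∀ n, 0 < d n) (hs : 0 < s)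
    (hlim : Tendsto (fun n => duhamel (f n) s y) atTop (𝓝 l))
    (hβ : ContinuousAt β (D (s, y) + l)) :
    Tendsto (fun n => -β (D (s - d n, y) + duhamel (f n) (s - d n) y)) atTop
      (𝓝 (-β (D (s, y) + l))) := by
  have hT1 : Tendsto (fun n => D (s - d n, y)) atTop (𝓝 (D (s, y))) := by
    have h3 : Tendsto (fun n => (s - d n, y)) atTop (𝓝 (s, y)) := by
      have := (tendsto_const_nhds (x := s)).sub hd
      rw [sub_zero] at this
      exact this.prodMk_nhds tendsto_const_nhds
    exact (hD.tendsto (s, y)).comp h3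
  have hT2 : Tendsto (fun n => duhamel (f n) (s - d n) y) atTop (𝓝 l) := by
    refine hlim.congr_dist ?_
    have h3 : Tendsto (fun n => M * s * d n) atTop (𝓝 0) := by
      simpa using hd.const_mul (M * s)
    refine squeeze_zero' (Eventually.of_forall fun _ => dist_nonneg) ?_ h3
    filter_upwards [hd.eventually_lt_const hs] with n hn
    rw [Real.dist_eq]
    refine (abs_duhamel_sub_le (hf n).measurable (hf n).abs_le (T := s)
      ⟨hs.le, le_rfl⟩ ⟨by linarith, by linarith [hdpos n]⟩ y y).trans (le_of_eq ?_)
    rw [sub_self, abs_zero, add_zero, sub_sub_cancel, abs_of_pos (hdpos n)]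
  exact (hβ.tendsto.comp (hT1.add hT2)).neg

/-- The weak limit of the delayed sources is identified off the levels `±1` by pointwise
convergence, and on them because both the limit and `β` vanish there. -/
theorem exists_mild_solution {β p : ℝ → ℝ} {c P M : ℝ} (hβ : Measurable β)
    (hM : ∀ s, |β s| ≤ M) (hβc : ∀ s, s ≠ 1 → s ≠ -1 → ContinuousAt β s) (hβ1 : β 1 = 0)
    (hβ2 : β (-1) = 0) (hpm : Measurable p) (hpi : ∀ a b, IntervalIntegrable p volume a b)
    (hpp : Function.Periodic p P) :
    ∃ u : ℝ × ℝ → ℝ, Continuous u ∧ (∀ t x, u (t, -x) = u (t, x)) ∧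
      (∀ t x, u (t, x + P) = u (t, x)) ∧
      ∀ t, 0 ≤ t → ∀ x, u (t, x) = freeWave c p t x + duhamel (fun z => -β (u z)) t x := by
  have hDc := continuous_freeWave (c := c) hpi
  have hDe : ∀ t x, freeWave c p t (-x) = freeWave c p t x := freeWave_neg c p
  have hDp : ∀ t x, freeWave c p t (x + P) = freeWave c p t x := freeWave_periodic hpi hpp
  -- Delay `1 / (n + 1)` and time horizon `n`: every fixed positive time is eventually covered.
  have hex := fun n : ℕ => exists_delayed_solution (P := P) hβ hM hDc hDe hDp
    (Nat.one_div_pos_of_nat (n := n) (α := ℝ)) n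
  choose F hF hFeq using hex
  obtain ⟨φ, hφ, g, hg, hgM, hweak⟩ := exists_weak_limit (fun n => (hF n).measurable)
    fun n => (hF n).abs_le
  have hlim : ∀ t, 0 ≤ t → ∀ x,
      Tendsto (fun n => duhamel (F (φ n)) t x) atTop (𝓝 (duhamel g t x)) := fun t ht x =>
    tendsto_duhamel_of_weak (fun n => (hF (φ n)).measurable) (fun n => (hF (φ n)).abs_le) hg hgM
      hweak ht x
  set u : ℝ × ℝ → ℝ := fun z => freeWave c p z.1 z.2 + duhamel g (max z.1 0) z.2
  have huc : Continuous u := hDc.add (continuous_duhamel hg hgM)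
  -- Symmetry is read off the Duhamel integrals, which converge pointwise; the weak limit `g` itself
  -- is only determined up to null sets.
  have hue : ∀ t x, u (t, -x) = u (t, x) := by
    intro t x
    have h1 := hlim _ (le_max_right t 0) (-x)
    simp only [fun n => duhamel_neg (hF (φ n)).even (max t 0) x] at h1
    simp only [u, hDe, tendsto_nhds_unique h1 (hlim _ (le_max_right t 0) x)]
  have hup : ∀ t x, u (t, x + P) = u (t, x) := by
    intro t x
    have h1 := hlim _ (le_max_right t 0) (x + P)
    simp only [fun n => duhamel_periodic (hF (φ n)).periodic (max t 0) x] at h1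
    simp only [u, hDp, tendsto_nhds_unique h1 (hlim _ (le_max_right t 0) x)]
  have huw : ∀ t, 0 ≤ t → ∀ x, u (t, x) = freeWave c p t x + duhamel g t x := fun t ht x => by
    simp only [u, max_eq_left ht]
  have hkm : Measurable fun z => -β (u z) := (hβ.comp huc.measurable).neg
  have hkM : ∀ z, |-β (u z)| ≤ M := fun z => by rw [abs_neg]; exact hM _
  have hpt : ∀ z : ℝ × ℝ, 0 < z.1 → u z ≠ 1 → u z ≠ -1 →
      Tendsto (fun n => F (φ n) z) atTop (𝓝 (-β (u z))) := by
    rintro ⟨s, y⟩ hs h1 h2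
    have hd : Tendsto (fun n => 1 / ((φ n : ℝ) + 1)) atTop (𝓝 0) :=
      (tendsto_one_div_add_atTop_nhds_zero_nat (𝕜 := ℝ)).comp hφ.tendsto_atTop
    have hev : ∀ᶠ n in atTop, s ≤ φ n :=
      (tendsto_natCast_atTop_atTop.comp hφ.tendsto_atTop).eventually_ge_atTop s
    have hcont := hβc _ h1 h2
    rw [huw s hs.le] at hcont ⊢
    have h3 := tendsto_delayedSource (fun n => hF (φ n)) hDc hd (fun n => Nat.one_div_pos_of_nat)
      hs (hlim s hs.le y) hcont
    refine h3.congr' ?_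
    filter_upwards [hev, hd.eventually_lt_const hs] with n hn1 hn2
    exact (hFeq (φ n) s hn2 hn1 y).symm
  have hoff : ∀ᵐ z : ℝ × ℝ, z ∈ {z : ℝ × ℝ | 0 < z.1 ∧ u z ≠ 1 ∧ u z ≠ -1} →
      g z = -β (u z) := by
    refine ae_eq_of_weak_of_pointwise (fun n => (hF (φ n)).measurable)
      (fun n => (hF (φ n)).abs_le) hg hgM hweak hkm hkM ?_ fun z hz => hpt z hz.1 hz.2.1 hz.2.2
    exact (measurableSet_lt measurable_const measurable_fst).inter
      ((measurableSet_eq_fun huc.measurable measurable_const).compl.inter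
        (measurableSet_eq_fun huc.measurable measurable_const).compl)
  have hae : ∀ᵐ z : ℝ × ℝ, 0 < z.1 → g z = -β (u z) := by
    filter_upwards [hoff, ae_source_eq_zero_of_level hpm hpi hg hgM huc.measurable huw 1,
      ae_source_eq_zero_of_level hpm hpi hg hgM huc.measurable huw (-1)] with z h0 h1 h2 hz
    by_cases h3 : u z = 1
    · rw [h1 hz h3, h3, hβ1, neg_zero]
    · by_cases h4 : u z = -1
      · rw [h2 hz h4, h4, hβ2, neg_zero]
      · exact h0 ⟨hz, h3, h4⟩
  refine ⟨u, huc, hue, hup, fun t ht x => ?_⟩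
  rw [huw t ht, duhamel_eq_setIntegral hg hgM ht, duhamel_eq_setIntegral hkm hkM ht]
  congr 2
  refine setIntegral_congr_ae (measurableSet_triangle t x) ?_
  filter_upwards [hae] with z hz hzA
  exact hz hzA.1.1

/-! ### Adhesion potentials -/

namespace IsAdhesionPotential

variable {Φ : ℝ → ℝ}

lemma contDiffAt (hΦ : IsAdhesionPotential Φ) {s : ℝ} (h1 : s ≠ 1) (h2 : s ≠ -1) :
    ContDiffAt ℝ 1 Φ s :=
  hΦ.contDiffOn.contDiffAt ((((finite_singleton _).insert _).isClosed.isOpen_compl).mem_nhds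
    (by simp [h1, h2]))

lemma differentiableAt (hΦ : IsAdhesionPotential Φ) {s : ℝ} (h1 : s ≠ 1) (h2 : s ≠ -1) :
    DifferentiableAt ℝ Φ s :=
  (hΦ.contDiffAt h1 h2).differentiableAt (by norm_num)

lemma continuousAt_deriv (hΦ : IsAdhesionPotential Φ) {s : ℝ} (h1 : s ≠ 1) (h2 : s ≠ -1) :
    ContinuousAt (deriv Φ) s := by
  have hopen : IsOpen ({1, -1}ᶜ : Set ℝ) := ((finite_singleton _).insert _).isClosed.isOpen_compl
  exact (hΦ.contDiffOn.continuousOn_deriv_of_isOpen hopen (by norm_num)).continuousAt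
    (hopen.mem_nhds (by simp [h1, h2]))

/-- If `Φ` is differentiable at `1`, the constant side forces the derivative to vanish; otherwise
`deriv` takes its default value `0`. -/
lemma deriv_one (hΦ : IsAdhesionPotential Φ) : deriv Φ 1 = 0 := by
  by_cases hd : DifferentiableAt ℝ Φ 1
  · obtain ⟨c, hc⟩ := hΦ.const_right
    have h1 := hd.hasDerivAt.hasDerivWithinAt (s := Ici 1)
    have h2 : HasDerivWithinAt Φ 0 (Ici 1) 1 :=
      (hasDerivWithinAt_const 1 (Ici 1) c).congr hc (hc 1 self_mem_Ici)
    exact (uniqueDiffOn_Ici 1 1 self_mem_Ici).eq_deriv _ h1 h2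
  · exact deriv_zero_of_not_differentiableAt hd

lemma deriv_neg_one (hΦ : IsAdhesionPotential Φ) : deriv Φ (-1) = 0 := by
  by_cases hd : DifferentiableAt ℝ Φ (-1)
  · obtain ⟨c, hc⟩ := hΦ.const_left
    have h1 := hd.hasDerivAt.hasDerivWithinAt (s := Iic (-1))
    have h2 : HasDerivWithinAt Φ 0 (Iic (-1)) (-1) :=
      (hasDerivWithinAt_const (-1) (Iic (-1)) c).congr hc (hc (-1) self_mem_Iic)
    exact (uniqueDiffOn_Iic (-1) (-1) self_mem_Iic).eq_deriv _ h1 h2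
  · exact deriv_zero_of_not_differentiableAt hd

lemma eq_projIcc (hΦ : IsAdhesionPotential Φ) (s : ℝ) :
    Φ s = Φ (projIcc (-1) 1 (by norm_num) s) := by
  obtain ⟨c, hc⟩ := hΦ.const_left
  obtain ⟨d, hd⟩ := hΦ.const_right
  rcases le_total s (-1) with h | h
  · rw [projIcc_of_le_left _ h, hc s h, hc (-1) self_mem_Iic]
  · rcases le_total 1 s with h' | h'
    · rw [projIcc_of_right_le _ h', hd s h', hd 1 self_mem_Ici]
    · rw [projIcc_of_mem _ ⟨h, h'⟩]

/-- The finite one-sided limits extend `Φ'` continuously from `(-1, 1)` to the compact interval, so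
it is bounded there. Globally `Φ` factors through the projection onto `[-1, 1]`, which does not
increase distances. -/
lemma exists_lipschitzWith (hΦ : IsAdhesionPotential Φ) : ∃ K : NNReal, LipschitzWith K Φ := by
  obtain ⟨l, hl⟩ := hΦ.limit_right
  obtain ⟨m, hm⟩ := hΦ.limit_left
  have hne : ∀ s ∈ Ioo (-1 : ℝ) 1, s ≠ 1 ∧ s ≠ -1 := fun s hs => ⟨hs.2.ne, hs.1.ne'⟩
  have hcont : ContinuousOn (deriv Φ) (Ioo (-1) 1) := fun s hs =>
    (hΦ.continuousAt_deriv (hne s hs).1 (hne s hs).2).continuousWithinAt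
  have hext := continuousOn_Icc_extendFrom_Ioo hcont hm hl
  obtain ⟨C, hC⟩ := isCompact_Icc.exists_bound_of_continuousOn hext
  have hbd : ∀ s ∈ Ioo (-1 : ℝ) 1, ‖deriv Φ s‖₊ ≤ C.toNNReal := by
    intro s hs
    rw [← NNReal.coe_le_coe, coe_nnnorm]
    refine le_trans ?_ (Real.le_coe_toNNReal C)
    rw [← extendFrom_extends hcont s hs]
    exact hC s (Ioo_subset_Icc_self hs)
  have h1 : LipschitzOnWith C.toNNReal Φ (Ioo (-1) 1) :=
    (convex_Ioo _ _).lipschitzOnWith_of_nnnorm_deriv_le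
      (fun s hs => hΦ.differentiableAt (hne s hs).1 (hne s hs).2) hbd
  have h2 := (lipschitzOnWith_closure_iff hΦ.continuous.continuousOn).2 h1
  rw [closure_Ioo (by norm_num)] at h2
  refine ⟨C.toNNReal, LipschitzWith.of_dist_le_mul fun s t => ?_⟩
  rw [hΦ.eq_projIcc s, hΦ.eq_projIcc t]
  refine (h2.dist_le_mul _ (Subtype.coe_prop _) _ (Subtype.coe_prop _)).trans ?_
  gcongr
  have h3 := (LipschitzWith.projIcc (by norm_num : (-1 : ℝ) ≤ 1)).dist_le_mul s t
  rwa [NNReal.coe_one, one_mul, Subtype.dist_eq] at h3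

lemma exists_abs_le (hΦ : IsAdhesionPotential Φ) : ∃ B, ∀ s, |Φ s| ≤ B := by
  obtain ⟨B, hB⟩ := (isCompact_Icc (a := (-1 : ℝ)) (b := 1)).exists_bound_of_continuousOn
    hΦ.continuous.continuousOn
  refine ⟨B, fun s => ?_⟩
  rw [hΦ.eq_projIcc s]
  exact hB _ (Subtype.coe_prop _)

end IsAdhesionPotential

/-! ### Even reflection and periodic extension -/

/-- The distance from `y` to `2Lℤ`, that is, the even `2L`-periodic extension of the identity
on `[0, L]`. -/
noncomputable def reflect (L y : ℝ) : ℝ := ‖(y : AddCircle (2 * L))‖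

section Reflect

variable {L : ℝ}

lemma reflect_periodic (L : ℝ) : Function.Periodic (reflect L) (2 * L) := fun y => by
  simp [reflect]

lemma reflect_of_abs_le (hL : 0 < L) {y : ℝ} (hy : |y| ≤ L) : reflect L y = |y| := by
  have hL2 : 0 < 2 * L := by linarith
  rw [reflect, AddCircle.norm_coe_eq_abs_iff (2 * L) hL2.ne', abs_of_pos hL2]
  linarith

lemma lipschitzWith_reflect (L : ℝ) : LipschitzWith 1 (reflect L) := by
  refine LipschitzWith.of_dist_le_mul fun x y => ?_
  rw [NNReal.coe_one, one_mul, Real.dist_eq, Real.dist_eq]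
  refine (abs_norm_sub_norm_le _ _).trans ?_
  rw [← AddCircle.coe_sub]
  exact QuotientAddGroup.norm_mk_le_norm

lemma deriv_reflect_periodic (L : ℝ) : Function.Periodic (deriv (reflect L)) (2 * L) := fun y => by
  rw [← deriv_comp_add_const]
  congr 1
  funext z
  exact reflect_periodic L z

lemma abs_deriv_reflect_le (L y : ℝ) : |deriv (reflect L) y| ≤ 1 := by
  simpa using norm_deriv_le_of_lipschitz (x₀ := y) (lipschitzWith_reflect L)

lemma reflect_of_mem (hL : 0 < L) {y : ℝ} (hy : y ∈ Icc 0 L) : reflect L y = y := by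
  rw [reflect_of_abs_le hL (abs_le.2 ⟨by linarith [hy.1], hy.2⟩), abs_of_nonneg hy.1]

lemma reflect_neg_of_mem (hL : 0 < L) {y : ℝ} (hy : y ∈ Icc 0 L) : reflect L (-y) = y := by
  rw [reflect_of_abs_le hL (by rw [abs_neg]; exact abs_le.2 ⟨by linarith [hy.1], hy.2⟩), abs_neg,
    abs_of_nonneg hy.1]

lemma deriv_reflect_of_mem (hL : 0 < L) {y : ℝ} (hy : y ∈ Ioo 0 L) : deriv (reflect L) y = 1 := by
  refine HasDerivAt.deriv ((hasDerivAt_id y).congr_of_eventuallyEq ?_)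
  filter_upwards [Ioo_mem_nhds hy.1 hy.2] with z hz
  exact reflect_of_mem hL (Ioo_subset_Icc_self hz)

lemma deriv_reflect_neg_of_mem (hL : 0 < L) {y : ℝ} (hy : y ∈ Ioo 0 L) :
    deriv (reflect L) (-y) = -1 := by
  refine HasDerivAt.deriv ((hasDerivAt_neg (-y)).congr_of_eventuallyEq ?_)
  filter_upwards [Ioo_mem_nhds (neg_lt_neg hy.2) (neg_lt_zero.2 hy.1)] with z hz
  have := reflect_neg_of_mem hL (y := -z) ⟨by linarith [hz.2], by linarith [hz.1]⟩
  simpa using this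

/-- The initial value of `(u_t + u_x) / 2`, extended to the line by reflection. -/
noncomputable def initialSpeed (L : ℝ) (v w : ℝ → ℝ) (a : ℝ) : ℝ :=
  2⁻¹ * (v (reflect L a) + deriv (reflect L) a * w (reflect L a))

lemma initialSpeed_periodic (L : ℝ) (v w : ℝ → ℝ) :
    Function.Periodic (initialSpeed L v w) (2 * L) := fun a => by
  simp only [initialSpeed, reflect_periodic L a, deriv_reflect_periodic L a]

lemma measurable_initialSpeed {v w : ℝ → ℝ} (hv : Measurable v) (hw : Measurable w) :
    Measurable (initialSpeed L v w) := by
  have hr : Measurable (reflect L) := (lipschitzWith_reflect L).continuous.measurable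
  exact ((hv.comp hr).add ((measurable_deriv _).mul (hw.comp hr))).const_mul _

lemma initialSpeed_of_mem (hL : 0 < L) (v w : ℝ → ℝ) {y : ℝ} (hy : y ∈ Ioo 0 L) :
    initialSpeed L v w y = 2⁻¹ * (v y + w y) := by
  rw [initialSpeed, deriv_reflect_of_mem hL hy, reflect_of_mem hL (Ioo_subset_Icc_self hy), one_mul]

lemma initialSpeed_neg_of_mem (hL : 0 < L) (v w : ℝ → ℝ) {y : ℝ} (hy : y ∈ Ioo 0 L) :
    initialSpeed L v w (-y) = 2⁻¹ * (v y - w y) := by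
  rw [initialSpeed, deriv_reflect_neg_of_mem hL hy, reflect_neg_of_mem hL (Ioo_subset_Icc_self hy)]
  ring

lemma intervalIntegrable_of_neg {h : ℝ → ℝ} (hL : 0 < L) (h1 : IntegrableOn h (Ioo 0 L))
    (h2 : IntegrableOn (fun y => h (-y)) (Ioo 0 L)) : IntervalIntegrable h volume (-L) L := by
  have h1' : IntervalIntegrable h volume 0 L := by
    rwa [intervalIntegrable_iff_integrableOn_Ioo_of_le hL.le]
  have h2' : IntervalIntegrable (fun y => h (-y)) volume 0 L := by
    rwa [intervalIntegrable_iff_integrableOn_Ioo_of_le hL.le]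
  have h3 : IntervalIntegrable h volume (-L) 0 := by
    simpa using (h2'.comp_sub_left 0).symm
  exact h3.trans h1'

lemma intervalIntegrable_initialSpeed_sq (hL : 0 < L) {v w : ℝ → ℝ} (hv : MemL2 L v)
    (hw : MemL2 L w) (a b : ℝ) :
    IntervalIntegrable (fun y => initialSpeed L v w y ^ 2) volume a b := by
  have hper : Function.Periodic (fun y => initialSpeed L v w y ^ 2) (2 * L) := fun y => by
    simp only [initialSpeed_periodic L v w y]
  refine hper.intervalIntegrable (t := -L) (by positivity) ?_ a b
  rw [show -L + 2 * L = L by ring]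
  have hadd : IntegrableOn (fun y => (2⁻¹ * (v y + w y)) ^ 2) (Ioo 0 L) :=
    ((MemLp.add hv hw).const_mul 2⁻¹).integrable_sq
  have hsub : IntegrableOn (fun y => (2⁻¹ * (v y - w y)) ^ 2) (Ioo 0 L) :=
    ((MemLp.sub hv hw).const_mul 2⁻¹).integrable_sq
  refine intervalIntegrable_of_neg hL ?_ ?_
  · exact hadd.congr_fun (fun y hy => by simp only [initialSpeed_of_mem hL v w hy])
      measurableSet_Ioo
  · exact hsub.congr_fun (fun y hy => by simp only [initialSpeed_neg_of_mem hL v w hy])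
      measurableSet_Ioo

lemma intervalIntegrable_of_sq {p : ℝ → ℝ} (hp : Measurable p)
    (h : ∀ a b, IntervalIntegrable (fun y => p y ^ 2) volume a b) (a b : ℝ) :
    IntervalIntegrable p volume a b := by
  refine ((h a b).add (intervalIntegrable_const (c := (1 : ℝ)))).mono_fun'
    hp.aestronglyMeasurable (Eventually.of_forall fun y => ?_)
  simp only [Real.norm_eq_abs]
  nlinarith [sq_abs (p y), sq_nonneg (|p y| - 1), sq_nonneg (p y)]

/-- Unfolding of an integral over `(0, L)` to a period. -/
lemma intervalIntegral_fold (hL : 0 < L) {h : ℝ → ℝ} (hp : Function.Periodic h (2 * L))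
    (hi : ∀ a b, IntervalIntegrable h volume a b) (t : ℝ) :
    ∫ y in (0 : ℝ)..L, (h (t + y) + h (t - y)) = ∫ a in (-L)..L, h a := by
  have h1 := intervalIntegral_symm_eq (intervalIntegrable_comp_add hi t (-L) L) hL.le
  simp only [← sub_eq_add_neg] at h1
  rw [← h1, intervalIntegral.integral_comp_add_left]
  have h2 := hp.intervalIntegral_add_eq (t + -L) (-L)
  rw [show t + -L + 2 * L = t + L by ring, show -L + 2 * L = L by ring] at h2
  exact h2

end Reflect

/-! ### Integrals over space-time boxes -/

/-- The shear `(t, x) ↦ (t, t + x)` preserves Lebesgue measure and maps a box into a larger box. -/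
lemma integrableOn_box_comp_add {g : ℝ × ℝ → ℝ}
    (hg : ∀ T a b, IntegrableOn g (Ioc 0 T ×ˢ Ioc a b)) (T a b : ℝ) :
    IntegrableOn (fun z : ℝ × ℝ => g (z.1, z.1 + z.2)) (Ioc 0 T ×ˢ Ioc a b) := by
  have hmeas : MeasurableSet (Ioc 0 T ×ˢ Ioc a (T + b)) := measurableSet_Ioc.prod measurableSet_Ioc
  have h1 : Integrable ((Ioc 0 T ×ˢ Ioc a (T + b)).indicator g) (volume.prod volume) :=
    (integrable_indicator_iff hmeas).2 (hg T a (T + b))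
  have h2 := (measurePreserving_prod_add (volume : Measure ℝ) (volume : Measure ℝ)).integrable_comp_of_integrable h1
  refine (h2.integrableOn (s := Ioc 0 T ×ˢ Ioc a b)).congr_fun (fun z hz => ?_)
    (measurableSet_Ioc.prod measurableSet_Ioc)
  have hz' : (z.1, z.1 + z.2) ∈ Ioc 0 T ×ˢ Ioc a (T + b) :=
    ⟨hz.1, by simp only; linarith [hz.1.1, hz.2.1], by simp only; linarith [hz.1.2, hz.2.2]⟩
  simp only [Function.comp, indicator_of_mem hz']

lemma integrableOn_box_comp_sub {g : ℝ × ℝ → ℝ}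
    (hg : ∀ T a b, IntegrableOn g (Ioc 0 T ×ˢ Ioc a b)) (T a b : ℝ) :
    IntegrableOn (fun z : ℝ × ℝ => g (z.1, z.1 - z.2)) (Ioc 0 T ×ˢ Ioc a b) := by
  have hmeas : MeasurableSet (Ioc 0 T ×ˢ Ioc (-b - 1) (T - a)) :=
    measurableSet_Ioc.prod measurableSet_Ioc
  have h1 : Integrable ((Ioc 0 T ×ˢ Ioc (-b - 1) (T - a)).indicator g) (volume.prod volume) :=
    (integrable_indicator_iff hmeas).2 (hg T (-b - 1) (T - a))
  have hneg : MeasurePreserving (Prod.map id Neg.neg : ℝ × ℝ → ℝ × ℝ) (volume.prod volume)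
      (volume.prod volume) := (MeasurePreserving.id volume).prod (Measure.measurePreserving_neg volume)
  have h2 := ((measurePreserving_prod_add (volume : Measure ℝ) (volume : Measure ℝ)).comp
    hneg).integrable_comp_of_integrable h1
  refine (h2.integrableOn (s := Ioc 0 T ×ˢ Ioc a b)).congr_fun (fun z hz => ?_)
    (measurableSet_Ioc.prod measurableSet_Ioc)
  have hz' : (z.1, z.1 + -z.2) ∈ Ioc 0 T ×ˢ Ioc (-b - 1) (T - a) :=
    ⟨hz.1, by simp only; linarith [hz.1.1, hz.2.2], by simp only; linarith [hz.1.2, hz.2.1]⟩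
  simp only [Function.comp, Prod.map, id]
  rw [indicator_of_mem hz', sub_eq_add_neg]

lemma integrableOn_mul_of_abs_le {α : Type*} [MeasurableSpace α] {μ : Measure α} {g k : α → ℝ}
    {s : Set α} {C : ℝ} (hg : IntegrableOn g s μ) (hk : Measurable k) (hC : ∀ z, |k z| ≤ C) :
    IntegrableOn (fun z => g z * k z) s μ :=
  Integrable.mul_bdd (c := C) hg hk.aestronglyMeasurable (Eventually.of_forall fun z => hC z)

lemma integrableOn_box_of_continuous {g : ℝ × ℝ → ℝ} (hg : Continuous g) (T a b : ℝ) :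
    IntegrableOn g (Ioc 0 T ×ˢ Ioc a b) :=
  (hg.continuousOn.integrableOn_compact (isCompact_Icc.prod isCompact_Icc)).mono_set
    (prod_mono Ioc_subset_Icc_self Ioc_subset_Icc_self)

lemma integrableOn_uIoc_prod {g : ℝ × ℝ → ℝ} {T a b : ℝ} (hT : 0 ≤ T) (hab : a ≤ b)
    (hg : IntegrableOn g (Ioc 0 T ×ˢ Ioc a b)) : IntegrableOn g (uIoc 0 T ×ˢ uIoc a b) := by
  rwa [uIoc_of_le hT, uIoc_of_le hab]

lemma box_ae_eq (T L : ℝ) :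
    (Ioc 0 T ×ˢ Ioo 0 L : Set (ℝ × ℝ)) =ᵐ[volume] (Ioc 0 T ×ˢ Ioc 0 L : Set (ℝ × ℝ)) := by
  rw [Measure.volume_eq_prod]
  exact Measure.set_prod_ae_eq (ae_eq_refl _) Ioo_ae_eq_Ioc

lemma measurableSet_strip (L : ℝ) : MeasurableSet (strip L) :=
  measurableSet_Ioi.prod measurableSet_Ioo

lemma setIntegral_strip_eq {g : ℝ × ℝ → ℝ} {T L : ℝ} (hT : 0 ≤ T) (hL : 0 ≤ L)
    (hg : IntegrableOn g (Ioc 0 T ×ˢ Ioc 0 L)) (h0 : ∀ z, T < z.1 → g z = 0) :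
    ∫ z in strip L, g z = ∫ t in (0 : ℝ)..T, ∫ x in (0 : ℝ)..L, g (t, x) := by
  have hsub : (Ioc 0 T ×ˢ Ioo 0 L : Set (ℝ × ℝ)) ⊆ strip L :=
    prod_mono (fun t ht => ht.1) subset_rfl
  rw [setIntegral_eq_of_subset_of_forall_sdiff_eq_zero
    (measurableSet_strip L) hsub fun z hz => h0 z ?_,
    setIntegral_congr_set (box_ae_eq T L), Measure.volume_eq_prod, setIntegral_prod g hg,
    intervalIntegral.integral_of_le hT]
  · simp only [intervalIntegral.integral_of_le hL]
  · by_contra hlt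
    exact hz.2 ⟨⟨hz.1.1, not_lt.1 hlt⟩, hz.1.2⟩

lemma setIntegral_strip_eq' {g : ℝ × ℝ → ℝ} {T L : ℝ} (hT : 0 ≤ T) (hL : 0 ≤ L)
    (hg : IntegrableOn g (Ioc 0 T ×ˢ Ioc 0 L)) (h0 : ∀ z, T < z.1 → g z = 0) :
    ∫ z in strip L, g z = ∫ x in (0 : ℝ)..L, ∫ t in (0 : ℝ)..T, g (t, x) := by
  rw [setIntegral_strip_eq hT hL hg h0,
    intervalIntegral_swap (h := fun t x => g (t, x)) (integrableOn_uIoc_prod hT hL hg)]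

lemma locallyIntegrableOn_strip {g : ℝ × ℝ → ℝ} {L : ℝ}
    (hg : ∀ T, IntegrableOn g (Ioc 0 T ×ˢ Ioc 0 L)) : LocallyIntegrableOn g (strip L) := by
  intro z hz
  refine ⟨Ioc 0 (z.1 + 1) ×ˢ Ioc 0 L, mem_nhdsWithin_of_mem_nhds ?_, hg _⟩
  have h1 : Ioo 0 (z.1 + 1) ×ˢ Ioo 0 L ∈ 𝓝 z :=
    (isOpen_Ioo.prod isOpen_Ioo).mem_nhds ⟨⟨hz.1, by linarith⟩, hz.2⟩
  exact mem_of_superset h1 (prod_mono Ioo_subset_Ioc_self Ioo_subset_Ioc_self)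

lemma exists_time_bound {φ : ℝ × ℝ → ℝ} (hφ : HasCompactSupport φ) :
    ∃ T, 0 < T ∧ ∀ z : ℝ × ℝ, T ≤ z.1 → z ∉ tsupport φ := by
  obtain ⟨C, hC⟩ := hφ.isCompact.exists_bound_of_continuousOn continuous_fst.continuousOn
  refine ⟨|C| + 1, by positivity, fun z hz hmem => ?_⟩
  have h1 := hC z hmem
  rw [Real.norm_eq_abs] at h1
  linarith [le_abs_self z.1, le_abs_self C]

lemma fderiv_apply_eq_zero {φ : ℝ × ℝ → ℝ} {z : ℝ × ℝ} (hz : z ∉ tsupport φ) (v : ℝ × ℝ) :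
    fderiv ℝ φ z v = 0 := by
  rw [image_eq_zero_of_notMem_tsupport fun h => hz (tsupport_fderiv_subset ℝ h)]
  rfl

lemma hasDerivAt_dt {φ : ℝ × ℝ → ℝ} (hφ : Differentiable ℝ φ) (t x : ℝ) :
    HasDerivAt (fun t => φ (t, x)) (dt φ (t, x)) t :=
  (hφ (t, x)).hasFDerivAt.comp_hasDerivAt t ((hasDerivAt_id t).prodMk (hasDerivAt_const t x))

lemma hasDerivAt_dx {φ : ℝ × ℝ → ℝ} (hφ : Differentiable ℝ φ) (t x : ℝ) :
    HasDerivAt (fun x => φ (t, x)) (dx φ (t, x)) x :=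
  (hφ (t, x)).hasFDerivAt.comp_hasDerivAt x ((hasDerivAt_const x t).prodMk (hasDerivAt_id x))

lemma continuous_dt {φ : ℝ × ℝ → ℝ} (hφ : ContDiff ℝ 1 φ) : Continuous (dt φ) :=
  (hφ.continuous_fderiv (by norm_num)).clm_apply continuous_const

lemma continuous_dx {φ : ℝ × ℝ → ℝ} (hφ : ContDiff ℝ 1 φ) : Continuous (dx φ) :=
  (hφ.continuous_fderiv (by norm_num)).clm_apply continuous_const

lemma contDiff_dt {φ : ℝ × ℝ → ℝ} (hφ : ContDiff ℝ ∞ φ) : ContDiff ℝ ∞ (dt φ) :=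
  (hφ.fderiv_right (m := ∞) (by simp)).clm_apply contDiff_const

lemma hasCompactSupport_dt {φ : ℝ × ℝ → ℝ} (hφ : HasCompactSupport φ) :
    HasCompactSupport (dt φ) :=
  hφ.fderiv_apply ℝ (1, 0)

lemma hasCompactSupport_dx {φ : ℝ × ℝ → ℝ} (hφ : HasCompactSupport φ) :
    HasCompactSupport (dx φ) :=
  hφ.fderiv_apply ℝ (0, 1)

/-! ### Weak derivatives of functions which are absolutely continuous on lines -/

/-- `v` is the time derivative of `u` along the lines `x = const`, in integrated form. -/
structure HasTimeDeriv (L : ℝ) (u v : ℝ × ℝ → ℝ) : Prop where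
  continuous : Continuous u
  integrableOn : ∀ T, IntegrableOn v (Ioc 0 T ×ˢ Ioc 0 L)
  intervalIntegrable : ∀ x a b, IntervalIntegrable (fun t => v (t, x)) volume a b
  eq_integral : ∀ x t, 0 ≤ t → u (t, x) = u (0, x) + ∫ s in (0 : ℝ)..t, v (s, x)

/-- `w` is the space derivative of `u` along the lines `t = const`, in integrated form. -/
structure HasSpaceDeriv (L : ℝ) (u w : ℝ × ℝ → ℝ) : Prop where
  continuous : Continuous u
  integrableOn : ∀ T, IntegrableOn w (Ioc 0 T ×ˢ Ioc 0 L)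
  intervalIntegrable : ∀ t a b, IntervalIntegrable (fun x => w (t, x)) volume a b
  eq_integral : ∀ t x, 0 ≤ t → u (t, x) = u (t, 0) + ∫ y in (0 : ℝ)..x, w (t, y)

section WeakDeriv

variable {L : ℝ} {u v w φ : ℝ × ℝ → ℝ}

lemma integrableOn_mul_test {g : ℝ × ℝ → ℝ} {s : Set (ℝ × ℝ)} (hg : IntegrableOn g s)
    (hφ : Continuous φ) (hφc : HasCompactSupport φ) : IntegrableOn (fun z => g z * φ z) s := by
  obtain ⟨C, hC⟩ := hφc.exists_bound_of_continuous hφ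
  exact integrableOn_mul_of_abs_le hg hφ.measurable hC

lemma HasTimeDeriv.integral_mul_dt (hu : HasTimeDeriv L u v) (hφ : ContDiff ℝ 1 φ) {T : ℝ}
    (hT : 0 ≤ T) {x : ℝ} (h0 : φ (T, x) = 0) :
    ∫ t in (0 : ℝ)..T, u (t, x) * dt φ (t, x) =
      -(u (0, x) * φ (0, x)) - ∫ t in (0 : ℝ)..T, v (t, x) * φ (t, x) := by
  have hc : Continuous fun t => dt φ (t, x) :=
    (continuous_dt hφ).comp (by fun_prop : Continuous fun t : ℝ => (t, x))
  rw [integral_mul_eq_of_eq_primitive hT (hu.intervalIntegrable x 0 T)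
    (hc.intervalIntegrable 0 T) (A := fun t => u (t, x)) (B := fun t => φ (t, x))
    (fun t ht => hu.eq_integral x t ht.1) fun t _ => ?_, h0]
  · ring
  · rw [intervalIntegral.integral_eq_sub_of_hasDerivAt
      (fun s _ => hasDerivAt_dt (hφ.differentiable (by norm_num)) s x) (hc.intervalIntegrable _ _)]
    ring

lemma HasSpaceDeriv.integral_mul_dx (hu : HasSpaceDeriv L u w) (hL : 0 ≤ L) (hφ : ContDiff ℝ 1 φ)
    {t : ℝ} (ht : 0 ≤ t) (h0 : φ (t, 0) = 0) (h1 : φ (t, L) = 0) :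
    ∫ x in (0 : ℝ)..L, u (t, x) * dx φ (t, x) = -∫ x in (0 : ℝ)..L, w (t, x) * φ (t, x) := by
  have hc : Continuous fun x => dx φ (t, x) :=
    (continuous_dx hφ).comp (by fun_prop : Continuous fun x : ℝ => (t, x))
  rw [integral_mul_eq_of_eq_primitive hL (hu.intervalIntegrable t 0 L)
    (hc.intervalIntegrable 0 L) (A := fun x => u (t, x)) (B := fun x => φ (t, x))
    (fun x _ => hu.eq_integral t x ht) fun x _ => ?_, h0, h1]
  · ring
  · rw [intervalIntegral.integral_eq_sub_of_hasDerivAt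
      (fun s _ => hasDerivAt_dx (hφ.differentiable (by norm_num)) t s) (hc.intervalIntegrable _ _)]
    ring

lemma HasTimeDeriv.isWeakDerivOn (hu : HasTimeDeriv L u v) (hL : 0 < L) :
    IsWeakDerivOn (strip L) (1, 0) u v := by
  refine ⟨locallyIntegrableOn_strip fun T => integrableOn_box_of_continuous hu.continuous T 0 L,
    locallyIntegrableOn_strip hu.integrableOn, fun φ hφ hφc hφs => ?_⟩
  have hφ1 : ContDiff ℝ 1 φ := hφ.of_le (by simp)
  obtain ⟨T, hT, hTs⟩ := exists_time_bound hφc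
  have hz : ∀ z : ℝ × ℝ, T ≤ z.1 → φ z = 0 := fun z h =>
    image_eq_zero_of_notMem_tsupport (hTs z h)
  have hz0 : ∀ x, φ (0, x) = 0 := fun x =>
    image_eq_zero_of_notMem_tsupport fun h => lt_irrefl (0 : ℝ) (hφs h).1
  change ∫ z in strip L, u z * dt φ z = _
  rw [setIntegral_strip_eq' hT.le hL.le (integrableOn_mul_test
      (integrableOn_box_of_continuous hu.continuous T 0 L) (continuous_dt hφ1)
      (hasCompactSupport_dt hφc))
      fun z h => by rw [dt, fderiv_apply_eq_zero (hTs z h.le), mul_zero],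
    setIntegral_strip_eq' hT.le hL.le (integrableOn_mul_test (hu.integrableOn T) hφ1.continuous hφc)
      fun z h => by rw [hz z h.le, mul_zero], ← intervalIntegral.integral_neg]
  refine intervalIntegral.integral_congr fun x _ => ?_
  rw [hu.integral_mul_dt hφ1 hT.le (hz (T, x) le_rfl), hz0]
  ring

lemma HasSpaceDeriv.isWeakDerivOn (hu : HasSpaceDeriv L u w) (hL : 0 < L) :
    IsWeakDerivOn (strip L) (0, 1) u w := by
  refine ⟨locallyIntegrableOn_strip fun T => integrableOn_box_of_continuous hu.continuous T 0 L,
    locallyIntegrableOn_strip hu.integrableOn, fun φ hφ hφc hφs => ?_⟩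
  have hφ1 : ContDiff ℝ 1 φ := hφ.of_le (by simp)
  obtain ⟨T, hT, hTs⟩ := exists_time_bound hφc
  have hz : ∀ z : ℝ × ℝ, T ≤ z.1 → φ z = 0 := fun z h =>
    image_eq_zero_of_notMem_tsupport (hTs z h)
  have hz0 : ∀ t, φ (t, 0) = 0 := fun t =>
    image_eq_zero_of_notMem_tsupport fun h => lt_irrefl (0 : ℝ) (hφs h).2.1
  have hzL : ∀ t, φ (t, L) = 0 := fun t =>
    image_eq_zero_of_notMem_tsupport fun h => lt_irrefl L (hφs h).2.2
  change ∫ z in strip L, u z * dx φ z = _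
  rw [setIntegral_strip_eq hT.le hL.le (integrableOn_mul_test
      (integrableOn_box_of_continuous hu.continuous T 0 L) (continuous_dx hφ1)
      (hasCompactSupport_dx hφc))
      fun z h => by rw [dx, fderiv_apply_eq_zero (hTs z h.le), mul_zero],
    setIntegral_strip_eq hT.le hL.le (integrableOn_mul_test (hu.integrableOn T) hφ1.continuous hφc)
      fun z h => by rw [hz z h.le, mul_zero], ← intervalIntegral.integral_neg]
  refine intervalIntegral.integral_congr fun t ht => ?_
  rw [uIcc_of_le hT.le] at ht
  exact hu.integral_mul_dx hL.le hφ1 ht.1 (hz0 t) (hzL t)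

end WeakDeriv

/-! ### The Neumann problem with a symmetric source -/

/-- The time derivative of the solution with symmetric data. -/
noncomputable def velocity (p : ℝ → ℝ) (f : ℝ × ℝ → ℝ) (z : ℝ × ℝ) : ℝ :=
  speedPlus p f z.1 (z.1 + z.2) + speedPlus p f z.1 (z.1 - z.2)

/-- The space derivative of the solution with symmetric data. -/
noncomputable def spaceSlope (p : ℝ → ℝ) (f : ℝ × ℝ → ℝ) (z : ℝ × ℝ) : ℝ :=
  speedPlus p f z.1 (z.1 + z.2) - speedPlus p f z.1 (z.1 - z.2)

section Neumann

variable {L M c : ℝ} {p : ℝ → ℝ} {f u : ℝ × ℝ → ℝ}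

lemma speedPlus_periodic (hpp : Function.Periodic p (2 * L)) (hf : IsSymmSource (2 * L) M f)
    (t : ℝ) : Function.Periodic (speedPlus p f t) (2 * L) := fun a => by
  simp only [speedPlus, hpp a, charPlus_periodic hf.periodic t a]

/-- Reflection in `x` exchanges the two families of characteristics, so one family on a full period
of length `2L` describes both on `(0, L)`. -/
lemma speedMinus_eq_speedPlus (hf : IsSymmSource (2 * L) M f) (t b : ℝ) :
    speedMinus p f t b = speedPlus p f t (-b) := by
  rw [speedMinus, speedPlus, charMinus_eq_charPlus hf.even]

lemma integrableOn_box_speedPlus (hpi : ∀ a b, IntervalIntegrable p volume a b)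
    (hf : IsSymmSource (2 * L) M f) (T a b : ℝ) :
    IntegrableOn (fun z : ℝ × ℝ => speedPlus p f z.1 z.2) (Ioc 0 T ×ˢ Ioc a b) := by
  have h1 : IntegrableOn (fun z : ℝ × ℝ => p z.2) (Ioc 0 T ×ˢ Ioc a b) := by
    rw [IntegrableOn, Measure.volume_eq_prod, ← Measure.prod_restrict]
    exact Integrable.comp_snd (hpi a b).1 _
  refine h1.add (Integrable.const_mul ?_ _)
  refine Measure.integrableOn_of_bounded (M := M * T) ?_
    (measurable_charPlus hf.measurable).aestronglyMeasurable ?_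
  · rw [Measure.volume_eq_prod, Measure.prod_prod]
    simp [ENNReal.mul_eq_top]
  · refine (ae_restrict_iff' (measurableSet_Ioc.prod measurableSet_Ioc)).2
      (Eventually.of_forall fun z hz => (abs_charPlus_le hf.abs_le _ _).trans ?_)
    rw [abs_of_pos hz.1.1]
    exact mul_le_mul_of_nonneg_left hz.1.2 ((abs_nonneg _).trans (hf.abs_le 0))

lemma integrableOn_box_velocity (hpi : ∀ a b, IntervalIntegrable p volume a b)
    (hf : IsSymmSource (2 * L) M f) (T a b : ℝ) :
    IntegrableOn (velocity p f) (Ioc 0 T ×ˢ Ioc a b) :=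
  (integrableOn_box_comp_add (integrableOn_box_speedPlus hpi hf) T a b).add
    (integrableOn_box_comp_sub (integrableOn_box_speedPlus hpi hf) T a b)

lemma integrableOn_box_slope (hpi : ∀ a b, IntervalIntegrable p volume a b)
    (hf : IsSymmSource (2 * L) M f) (T a b : ℝ) :
    IntegrableOn (spaceSlope p f) (Ioc 0 T ×ˢ Ioc a b) :=
  (integrableOn_box_comp_add (integrableOn_box_speedPlus hpi hf) T a b).sub
    (integrableOn_box_comp_sub (integrableOn_box_speedPlus hpi hf) T a b)

lemma velocity_eq (hf : IsSymmSource (2 * L) M f) (t x : ℝ) :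
    velocity p f (t, x) = speedPlus p f t (x + t) + speedMinus p f t (x - t) := by
  rw [speedMinus_eq_speedPlus hf, neg_sub, velocity, add_comm t x]

lemma slope_eq (hf : IsSymmSource (2 * L) M f) (t x : ℝ) :
    spaceSlope p f (t, x) = speedPlus p f t (x + t) - speedMinus p f t (x - t) := by
  rw [speedMinus_eq_speedPlus hf, neg_sub, spaceSlope, add_comm t x]

lemma measurable_velocity (hpm : Measurable p) (hf : Measurable f) : Measurable (velocity p f) :=
  ((measurable_speedPlus hpm hf).comp
    (by fun_prop : Measurable fun z : ℝ × ℝ => (z.1, z.1 + z.2))).add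
  ((measurable_speedPlus hpm hf).comp
    (by fun_prop : Measurable fun z : ℝ × ℝ => (z.1, z.1 - z.2)))

lemma measurable_slope (hpm : Measurable p) (hf : Measurable f) : Measurable (spaceSlope p f) :=
  ((measurable_speedPlus hpm hf).comp
    (by fun_prop : Measurable fun z : ℝ × ℝ => (z.1, z.1 + z.2))).sub
  ((measurable_speedPlus hpm hf).comp
    (by fun_prop : Measurable fun z : ℝ × ℝ => (z.1, z.1 - z.2)))

lemma hasTimeDeriv_velocity (hpi : ∀ a b, IntervalIntegrable p volume a b)
    (hf : IsSymmSource (2 * L) M f) (hu : Continuous u)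
    (hw : ∀ t, 0 ≤ t → ∀ x, u (t, x) = freeWave c p t x + duhamel f t x) :
    HasTimeDeriv L u (velocity p f) where
  continuous := hu
  integrableOn T := integrableOn_box_velocity hpi hf T 0 L
  intervalIntegrable x a b := by
    simp only [velocity_eq hf]
    exact (intervalIntegrable_speedPlus_time hpi hf.measurable hf.abs_le x a b).add
      (intervalIntegrable_speedMinus_time hpi hf.measurable hf.abs_le x a b)
  eq_integral x t ht := by
    simp only [velocity_eq hf]
    rw [hw t ht, hw 0 le_rfl]
    exact wave_eq_integral_time hpi hf.measurable hf.abs_le ht x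

lemma hasSpaceDeriv_slope (hpi : ∀ a b, IntervalIntegrable p volume a b)
    (hf : IsSymmSource (2 * L) M f) (hu : Continuous u)
    (hw : ∀ t, 0 ≤ t → ∀ x, u (t, x) = freeWave c p t x + duhamel f t x) :
    HasSpaceDeriv L u (spaceSlope p f) where
  continuous := hu
  integrableOn T := integrableOn_box_slope hpi hf T 0 L
  intervalIntegrable t a b := by
    simp only [slope_eq hf]
    exact (intervalIntegrable_speedPlus_space hpi hf.measurable hf.abs_le t a b).sub
      (intervalIntegrable_speedMinus_space hpi hf.measurable hf.abs_le t a b)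
  eq_integral t x ht := by
    simp only [slope_eq hf]
    rw [hw t ht, hw t ht]
    exact wave_eq_integral_space hpi hf.measurable hf.abs_le t x

lemma speedPlus_zero (p : ℝ → ℝ) (f : ℝ × ℝ → ℝ) (a : ℝ) : speedPlus p f 0 a = p a := by
  simp [speedPlus, charPlus]

lemma speedPlus_eq_integral (p : ℝ → ℝ) (f : ℝ × ℝ → ℝ) (t a : ℝ) :
    speedPlus p f t a = speedPlus p f 0 a + ∫ s in (0 : ℝ)..t, 2⁻¹ * f (s, a - s) := by
  rw [speedPlus_zero, speedPlus, charPlus, intervalIntegral.integral_const_mul]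

lemma intervalIntegrable_along (hf : IsSymmSource (2 * L) M f) (a b d : ℝ) :
    IntervalIntegrable (fun s => f (s, a - s)) volume b d :=
  intervalIntegrable_of_abs_le (hf.measurable.comp (by fun_prop)) (fun s => hf.abs_le (s, a - s))
    b d

lemma intervalIntegrable_speedPlus_sq (hpm : Measurable p)
    (hp2 : ∀ a b, IntervalIntegrable (fun y => p y ^ 2) volume a b)
    (hf : IsSymmSource (2 * L) M f) (t a b : ℝ) :
    IntervalIntegrable (fun y => speedPlus p f t y ^ 2) volume a b := by
  refine (((hp2 a b).const_mul 2).add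
    (intervalIntegrable_const (c := (M * |t|) ^ 2))).mono_fun'
    (((measurable_speedPlus hpm hf.measurable).comp measurable_prodMk_left).pow_const
      2).aestronglyMeasurable (Eventually.of_forall fun y => ?_)
  simp only [norm_pow, Real.norm_eq_abs, sq_abs]
  have h1 := abs_charPlus_le hf.abs_le t y
  have h2 := sq_le_sq' (neg_le_of_abs_le h1) (le_of_abs_le h1)
  rw [speedPlus]
  nlinarith [sq_nonneg (p y - 2⁻¹ * charPlus f t y)]

lemma memLp_speedPlus_comp (hpm : Measurable p)
    (hp2 : ∀ a b, IntervalIntegrable (fun y => p y ^ 2) volume a b)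
    (hf : IsSymmSource (2 * L) M f) (hL : 0 < L) (t : ℝ) :
    MemL2 L (fun y => speedPlus p f t (t + y)) ∧ MemL2 L (fun y => speedPlus p f t (t - y)) := by
  have hm := (measurable_speedPlus hpm hf.measurable).comp
    (measurable_prodMk_left : Measurable (Prod.mk t))
  have h2 := intervalIntegrable_speedPlus_sq hpm hp2 hf t
  constructor
  · refine (memLp_two_iff_integrable_sq
      (hm.comp (by fun_prop : Measurable fun y : ℝ => t + y)).aestronglyMeasurable).2 ?_
    exact (intervalIntegrable_iff_integrableOn_Ioo_of_le hL.le).1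
      (intervalIntegrable_comp_add h2 t 0 L)
  · refine (memLp_two_iff_integrable_sq
      (hm.comp (by fun_prop : Measurable fun y : ℝ => t - y)).aestronglyMeasurable).2 ?_
    exact (intervalIntegrable_iff_integrableOn_Ioo_of_le hL.le).1
      (intervalIntegrable_comp_sub h2 t 0 L)

lemma memL2_velocity (hpm : Measurable p)
    (hp2 : ∀ a b, IntervalIntegrable (fun y => p y ^ 2) volume a b)
    (hf : IsSymmSource (2 * L) M f) (hL : 0 < L) (t : ℝ) :
    MemL2 L (fun y => velocity p f (t, y)) :=
  MemLp.add (memLp_speedPlus_comp hpm hp2 hf hL t).1 (memLp_speedPlus_comp hpm hp2 hf hL t).2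

lemma memL2_slope (hpm : Measurable p)
    (hp2 : ∀ a b, IntervalIntegrable (fun y => p y ^ 2) volume a b)
    (hf : IsSymmSource (2 * L) M f) (hL : 0 < L) (t : ℝ) :
    MemL2 L (fun y => spaceSlope p f (t, y)) :=
  MemLp.sub (memLp_speedPlus_comp hpm hp2 hf hL t).1 (memLp_speedPlus_comp hpm hp2 hf hL t).2

lemma intervalIntegrable_speedPlus (hpi : ∀ a b, IntervalIntegrable p volume a b)
    (hf : IsSymmSource (2 * L) M f) (t a b : ℝ) :
    IntervalIntegrable (speedPlus p f t) volume a b :=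
  (hpi a b).add ((intervalIntegrable_of_abs_le ((measurable_charPlus hf.measurable).comp
    measurable_prodMk_left) (fun y => abs_charPlus_le hf.abs_le t y) a b).const_mul _)

/-- By the parallelogram law the integrand is `A² + B²` with `A`, `B` the values of `speedPlus` at
`t + y` and `t - y`. As `y` runs through `(0, L)` these two labels cover one period. -/
lemma integral_kinetic_eq (hL : 0 < L) (hpm : Measurable p)
    (hp2 : ∀ a b, IntervalIntegrable (fun y => p y ^ 2) volume a b)
    (hpp : Function.Periodic p (2 * L)) (hf : IsSymmSource (2 * L) M f) (t : ℝ) :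
    ∫ y in (0 : ℝ)..L, (velocity p f (t, y) ^ 2 + spaceSlope p f (t, y) ^ 2) / 2 =
      ∫ a in (-L)..L, speedPlus p f t a ^ 2 := by
  rw [← intervalIntegral_fold hL (h := fun a => speedPlus p f t a ^ 2)
    (fun a => by simp only [speedPlus_periodic hpp hf t a])
    (intervalIntegrable_speedPlus_sq hpm hp2 hf t) t]
  refine intervalIntegral.integral_congr fun y _ => ?_
  simp only [velocity, spaceSlope]
  ring

/-- The power of the source, computed along characteristics. -/
lemma integral_source_mul_velocity (hL : 0 < L)
    (hpi : ∀ a b, IntervalIntegrable p volume a b)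
    (hpp : Function.Periodic p (2 * L)) (hf : IsSymmSource (2 * L) M f) {T : ℝ} (hT : 0 ≤ T) :
    ∫ a in (-L)..L, ∫ s in (0 : ℝ)..T, speedPlus p f s a * f (s, a - s) =
      ∫ x in (0 : ℝ)..L, ∫ t in (0 : ℝ)..T, f (t, x) * velocity p f (t, x) := by
  have hfm : Measurable fun z : ℝ × ℝ => f (z.1, z.2 - z.1) :=
    hf.measurable.comp (by fun_prop)
  have hbox : IntegrableOn (fun z : ℝ × ℝ => speedPlus p f z.1 z.2 * f (z.1, z.2 - z.1))
      (Ioc 0 T ×ˢ Ioc (-L) L) :=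
    integrableOn_mul_of_abs_le (integrableOn_box_speedPlus hpi hf T (-L) L) hfm fun z => hf.abs_le _
  have hbox' : IntegrableOn (fun z : ℝ × ℝ => f z * velocity p f z) (Ioc 0 T ×ˢ Ioc 0 L) := by
    simpa only [mul_comm] using
      integrableOn_mul_of_abs_le (integrableOn_box_velocity hpi hf T 0 L) hf.measurable hf.abs_le
  rw [← intervalIntegral_swap (h := fun s a => speedPlus p f s a * f (s, a - s))
      (integrableOn_uIoc_prod hT (by linarith) hbox),
    ← intervalIntegral_swap (h := fun t x => f (t, x) * velocity p f (t, x))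
      (integrableOn_uIoc_prod hT hL.le hbox')]
  refine intervalIntegral.integral_congr fun s _ => ?_
  rw [← intervalIntegral_fold hL (h := fun a => speedPlus p f s a * f (s, a - s))
    (fun a => ?_) (fun a b => ?_) s]
  · refine intervalIntegral.integral_congr fun y _ => ?_
    simp only [velocity]
    rw [show s + y - s = y by ring, show s - y - s = -y by ring, hf.even]
    ring
  · simp only
    rw [speedPlus_periodic hpp hf s a, show a + 2 * L - s = a - s + 2 * L by ring, hf.periodic]
  · have h := intervalIntegrable_speedPlus hpi hf s a b
    have hm : Measurable fun a => f (s, a - s) := hf.measurable.comp (by fun_prop)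
    exact ⟨integrableOn_mul_of_abs_le h.1 hm fun z => hf.abs_le _,
      integrableOn_mul_of_abs_le h.2 hm fun z => hf.abs_le _⟩

/-- At a fixed label `a`, `speedPlus` has time derivative `f / 2`, so its square has derivative
`speedPlus * f`. Integrating over the labels of one period and unshearing gives the power of the
source. -/
lemma kinetic_energy_identity (hL : 0 < L) (hpm : Measurable p)
    (hp2 : ∀ a b, IntervalIntegrable (fun y => p y ^ 2) volume a b)
    (hpp : Function.Periodic p (2 * L)) (hf : IsSymmSource (2 * L) M f) {T : ℝ} (hT : 0 ≤ T) :
    ∫ y in (0 : ℝ)..L, (velocity p f (T, y) ^ 2 + spaceSlope p f (T, y) ^ 2) / 2 =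
      (∫ y in (0 : ℝ)..L, (velocity p f (0, y) ^ 2 + spaceSlope p f (0, y) ^ 2) / 2) +
      ∫ x in (0 : ℝ)..L, ∫ t in (0 : ℝ)..T, f (t, x) * velocity p f (t, x) := by
  have hpi := intervalIntegrable_of_sq hpm hp2
  rw [integral_kinetic_eq hL hpm hp2 hpp hf, integral_kinetic_eq hL hpm hp2 hpp hf,
    ← integral_source_mul_velocity hL hpi hpp hf hT]
  have hsq := fun t => intervalIntegrable_speedPlus_sq hpm hp2 hf t (-L) L
  have key : ∀ a, speedPlus p f T a ^ 2 = speedPlus p f 0 a ^ 2 +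
      ∫ s in (0 : ℝ)..T, speedPlus p f s a * f (s, a - s) := by
    intro a
    have hI : IntervalIntegrable (fun s => 2⁻¹ * f (s, a - s)) volume 0 T :=
      (intervalIntegrable_along hf a 0 T).const_mul _
    have h1 := integral_mul_eq_of_eq_primitive hT hI hI
      (A := fun t => speedPlus p f t a) (B := fun t => speedPlus p f t a)
      (fun t _ => speedPlus_eq_integral p f t a) (fun t _ => speedPlus_eq_integral p f t a)
    have e1 : ∀ t, speedPlus p f t a * (2⁻¹ * f (t, a - t))
        = 2⁻¹ * (speedPlus p f t a * f (t, a - t)) := fun t => by ring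
    have e2 : ∀ t, 2⁻¹ * f (t, a - t) * speedPlus p f t a
        = 2⁻¹ * (speedPlus p f t a * f (t, a - t)) := fun t => by ring
    simp only [e1, e2, intervalIntegral.integral_const_mul] at h1
    linarith
  rw [← sub_eq_iff_eq_add', ← intervalIntegral.integral_sub (hsq T) (hsq 0)]
  refine intervalIntegral.integral_congr fun a _ => ?_
  linarith [key a]

/-! ### The weak formulation -/

/-- The derivative of a reflected test function along characteristics. -/
noncomputable def reflectDeriv (L : ℝ) (φ : ℝ × ℝ → ℝ) (z : ℝ × ℝ) : ℝ :=
  dt φ (z.1, reflect L z.2) - deriv (reflect L) z.2 * dx φ (z.1, reflect L z.2)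

lemma measurable_reflectDeriv {φ : ℝ × ℝ → ℝ} (hφ : ContDiff ℝ 1 φ) :
    Measurable (reflectDeriv L φ) := by
  have hr : Measurable (reflect L) := (lipschitzWith_reflect L).continuous.measurable
  have hm : Measurable fun z : ℝ × ℝ => (z.1, reflect L z.2) :=
    measurable_fst.prodMk (hr.comp measurable_snd)
  exact ((continuous_dt hφ).measurable.comp hm).sub
    (((measurable_deriv _).comp measurable_snd).mul ((continuous_dx hφ).measurable.comp hm))

lemma exists_abs_reflectDeriv_le (L : ℝ) {φ : ℝ × ℝ → ℝ} (hφ : ContDiff ℝ 1 φ)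
    (hφc : HasCompactSupport φ) : ∃ C, ∀ z, |reflectDeriv L φ z| ≤ C := by
  obtain ⟨A, hA⟩ := (hasCompactSupport_dt hφc).exists_bound_of_continuous (continuous_dt hφ)
  obtain ⟨B, hB⟩ := (hasCompactSupport_dx hφc).exists_bound_of_continuous (continuous_dx hφ)
  refine ⟨A + B, fun z => (abs_sub _ _).trans (add_le_add (hA _) ?_)⟩
  rw [abs_mul]
  exact (mul_le_of_le_one_left (abs_nonneg _) (abs_deriv_reflect_le L _)).trans (hB _)

/-- The reflected test function may have corners, but it is Lipschitz along characteristics, which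
is enough for the fundamental theorem of calculus. -/
lemma reflect_test_eq_integral {φ : ℝ × ℝ → ℝ} (hφ : ContDiff ℝ 1 φ) (hφc : HasCompactSupport φ)
    (a t : ℝ) : φ (t, reflect L (a - t)) = φ (0, reflect L (a - 0)) +
      ∫ s in (0 : ℝ)..t, reflectDeriv L φ (s, a - s) := by
  obtain ⟨C, hC⟩ := ContDiff.lipschitzWith_of_hasCompactSupport hφc hφ (by norm_num)
  have h1 : LipschitzWith 1 fun t : ℝ => a - t := by
    refine LipschitzWith.of_dist_le_mul fun x y => ?_
    rw [NNReal.coe_one, one_mul, dist_sub_left]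
  have h2 : LipschitzWith (C * max 1 (1 * 1)) fun t => φ (t, reflect L (a - t)) :=
    hC.comp (LipschitzWith.id.prodMk ((lipschitzWith_reflect L).comp h1))
  have h3 := (h2.lipschitzOnWith (s := uIcc 0 t)).absolutelyContinuousOnInterval.integral_deriv_eq_sub
  rw [← sub_eq_iff_eq_add', ← h3]
  refine intervalIntegral.integral_congr_ae ?_
  have h4 : ∀ᵐ s : ℝ, DifferentiableAt ℝ (reflect L) (a - s) :=
    (Measure.measurePreserving_sub_left volume a).quasiMeasurePreserving.ae
      (lipschitzWith_reflect L).ae_differentiableAt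
  filter_upwards [h4] with s hs _
  have h5 : HasDerivAt (fun s => reflect L (a - s)) (-deriv (reflect L) (a - s)) s := by
    simpa using hs.hasDerivAt.comp_const_sub a s
  have h6 := ((hφ.differentiable (by norm_num)) (s, reflect L (a - s))).hasFDerivAt.comp_hasDerivAt
    s ((hasDerivAt_id s).prodMk h5)
  refine h6.deriv.trans ?_
  have h7 : ((1 : ℝ), -deriv (reflect L) (a - s))
      = (1, 0) + (-deriv (reflect L) (a - s)) • ((0 : ℝ), (1 : ℝ)) := by simp
  rw [h7, map_add, map_smul, smul_eq_mul, reflectDeriv, dt, dx]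
  ring

/-- With `A`, `B` the values of `speedPlus` at `t + x` and `t - x`, the integrand is `A (φ_t - φ_x)
+ B (φ_t + φ_x)`. On the unfolded period both terms are `speedPlus` times the derivative of the
reflected `φ` along `x + t = a`, and one integrates by parts in `t` at fixed `a`. No boundary terms
arise at `x = 0, L`, although `φ` need not vanish there: this is the weak Neumann condition. -/
lemma integral_velocity_dt_sub_slope_dx (hL : 0 < L)
    (hpi : ∀ a b, IntervalIntegrable p volume a b)
    (hpp : Function.Periodic p (2 * L)) (hf : IsSymmSource (2 * L) M f) {φ : ℝ × ℝ → ℝ}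
    (hφ : ContDiff ℝ 1 φ) (hφc : HasCompactSupport φ) {T : ℝ} (hT : 0 ≤ T)
    (h0 : ∀ x, φ (T, x) = 0) :
    ∫ t in (0 : ℝ)..T, ∫ x in (0 : ℝ)..L,
        (velocity p f (t, x) * dt φ (t, x) - spaceSlope p f (t, x) * dx φ (t, x)) =
      -(∫ x in (0 : ℝ)..L, velocity p f (0, x) * φ (0, x)) -
        ∫ t in (0 : ℝ)..T, ∫ x in (0 : ℝ)..L, f (t, x) * φ (t, x) := by
  obtain ⟨C, hC⟩ := exists_abs_reflectDeriv_le L hφ hφc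
  obtain ⟨A, hA⟩ := hφc.exists_bound_of_continuous hφ.continuous
  have hψm := measurable_reflectDeriv (L := L) hφ
  have hrc : Continuous (reflect L) := (lipschitzWith_reflect L).continuous
  have hper : ∀ s, Function.Periodic (fun a => reflect L (a - s)) (2 * L) := fun s a => by
    simp only
    rw [show a + 2 * L - s = a - s + 2 * L by ring, reflect_periodic L]
  have hper' : ∀ s, Function.Periodic (fun a => reflectDeriv L φ (s, a - s)) (2 * L) :=
    fun s a => by
      simp only [reflectDeriv]
      rw [show a + 2 * L - s = a - s + 2 * L by ring, reflect_periodic L, deriv_reflect_periodic L]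
  have hmul : ∀ {g k : ℝ → ℝ} {B : ℝ}, (∀ a b, IntervalIntegrable g volume a b) → Measurable k →
      (∀ y, |k y| ≤ B) → ∀ a b, IntervalIntegrable (fun y => g y * k y) volume a b :=
    fun hg hk hB a b => ⟨integrableOn_mul_of_abs_le (hg a b).1 hk hB,
      integrableOn_mul_of_abs_le (hg a b).2 hk hB⟩
  have hslice : ∀ s : ℝ, Measurable fun a : ℝ => reflectDeriv L φ (s, a - s) := fun s =>
    hψm.comp (by fun_prop)
  -- unfold to a full period and shift along characteristics
  have e1 : ∀ t, ∫ x in (0 : ℝ)..L,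
      (velocity p f (t, x) * dt φ (t, x) - spaceSlope p f (t, x) * dx φ (t, x)) =
      ∫ a in (-L)..L, speedPlus p f t a * reflectDeriv L φ (t, a - t) := by
    intro t
    rw [← intervalIntegral_fold hL (h := fun a => speedPlus p f t a * reflectDeriv L φ (t, a - t))
      ((speedPlus_periodic hpp hf t).mul (hper' t))
      (hmul (intervalIntegrable_speedPlus hpi hf t) (hslice t) fun _ => hC _) t]
    rw [intervalIntegral_eq_integral_Ioo hL.le, intervalIntegral_eq_integral_Ioo hL.le]
    refine setIntegral_congr_fun measurableSet_Ioo fun y hy => ?_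
    have hy' := Ioo_subset_Icc_self hy
    simp only [velocity, spaceSlope, reflectDeriv]
    rw [show t + y - t = y by ring, show t - y - t = -y by ring, reflect_of_mem hL hy',
      reflect_neg_of_mem hL hy', deriv_reflect_of_mem hL hy, deriv_reflect_neg_of_mem hL hy]
    ring
  have e2 : ∀ t, ∫ x in (0 : ℝ)..L, f (t, x) * φ (t, x) =
      ∫ a in (-L)..L, 2⁻¹ * (f (t, a - t) * φ (t, reflect L (a - t))) := by
    intro t
    have hm1 : Measurable fun a => f (t, a - t) := hf.measurable.comp (by fun_prop)
    have hm2 : Measurable fun a => φ (t, reflect L (a - t)) :=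
      hφ.continuous.measurable.comp (by fun_prop : Continuous fun a : ℝ =>
        (t, reflect L (a - t))).measurable
    rw [← intervalIntegral_fold hL
      (h := fun a => 2⁻¹ * (f (t, a - t) * φ (t, reflect L (a - t)))) (fun a => ?_)
      (fun a b => (hmul (fun a b => intervalIntegrable_of_abs_le hm1 (fun _ => hf.abs_le _) a b)
        hm2 (fun _ => hA _) a b).const_mul _) t]
    · rw [intervalIntegral_eq_integral_Ioo hL.le, intervalIntegral_eq_integral_Ioo hL.le]
      refine setIntegral_congr_fun measurableSet_Ioo fun y hy => ?_
      have hy' := Ioo_subset_Icc_self hy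
      rw [show t + y - t = y by ring, show t - y - t = -y by ring, reflect_of_mem hL hy',
        reflect_neg_of_mem hL hy', hf.even]
      ring
    · have := hper t a
      simp only at this ⊢
      rw [this, show a + 2 * L - t = a - t + 2 * L by ring, hf.periodic]
  have e3 : ∫ x in (0 : ℝ)..L, velocity p f (0, x) * φ (0, x) =
      ∫ a in (-L)..L, speedPlus p f 0 a * φ (0, reflect L (a - 0)) := by
    have hm2 : Measurable fun a => φ (0, reflect L (a - 0)) :=
      hφ.continuous.measurable.comp (by fun_prop : Continuous fun a : ℝ =>
        ((0 : ℝ), reflect L (a - 0))).measurable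
    rw [← intervalIntegral_fold hL (h := fun a => speedPlus p f 0 a * φ (0, reflect L (a - 0)))
      (fun a => ?_) (hmul (intervalIntegrable_speedPlus hpi hf 0) hm2 fun _ => hA _) 0]
    · rw [intervalIntegral_eq_integral_Ioo hL.le, intervalIntegral_eq_integral_Ioo hL.le]
      refine setIntegral_congr_fun measurableSet_Ioo fun y hy => ?_
      have hy' := Ioo_subset_Icc_self hy
      simp only [velocity, sub_zero]
      rw [zero_add, zero_sub, reflect_of_mem hL hy', reflect_neg_of_mem hL hy']
      ring
    · have := hper 0 a
      simp only at this ⊢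
      rw [this, speedPlus_periodic hpp hf 0 a]
  simp only [e1, e2, e3]
  have hm3 : Measurable fun z : ℝ × ℝ => reflectDeriv L φ (z.1, z.2 - z.1) :=
    hψm.comp (by fun_prop)
  have hm4 : Measurable fun z : ℝ × ℝ => 2⁻¹ * (f (z.1, z.2 - z.1) *
      φ (z.1, reflect L (z.2 - z.1))) :=
    ((hf.measurable.comp (by fun_prop)).mul (hφ.continuous.measurable.comp
      (by fun_prop : Continuous fun z : ℝ × ℝ => (z.1, reflect L (z.2 - z.1))).measurable)).const_mul _
  have hb4 : ∀ t a : ℝ, |2⁻¹ * (f (t, a - t) * φ (t, reflect L (a - t)))| ≤ 2⁻¹ * (M * A) := by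
    intro t a
    rw [abs_mul, abs_mul, abs_of_pos (by norm_num : (0 : ℝ) < 2⁻¹)]
    have := mul_le_mul (hf.abs_le (t, a - t)) (hA (t, reflect L (a - t))) (norm_nonneg _)
      ((abs_nonneg _).trans (hf.abs_le 0))
    rw [Real.norm_eq_abs] at this
    linarith
  rw [intervalIntegral_swap (h := fun t a => speedPlus p f t a * reflectDeriv L φ (t, a - t))
      (integrableOn_uIoc_prod hT (by linarith)
        (integrableOn_mul_of_abs_le (integrableOn_box_speedPlus hpi hf T (-L) L) hm3 fun _ => hC _)),
    intervalIntegral_swap_of_abs_le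
      (h := fun t a => 2⁻¹ * (f (t, a - t) * φ (t, reflect L (a - t)))) hm4 hb4]
  have hparts : ∀ a, ∫ t in (0 : ℝ)..T, speedPlus p f t a * reflectDeriv L φ (t, a - t) =
      -(speedPlus p f 0 a * φ (0, reflect L (a - 0))) -
        ∫ t in (0 : ℝ)..T, 2⁻¹ * (f (t, a - t) * φ (t, reflect L (a - t))) := by
    intro a
    have hψa : Measurable fun s : ℝ => reflectDeriv L φ (s, a - s) := hψm.comp (by fun_prop)
    rw [integral_mul_eq_of_eq_primitive hT ((intervalIntegrable_along hf a 0 T).const_mul 2⁻¹)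
      (intervalIntegrable_of_abs_le hψa (fun _ => hC _) 0 T)
      (A := fun t => speedPlus p f t a) (B := fun t => φ (t, reflect L (a - t)))
      (fun t _ => speedPlus_eq_integral p f t a)
      (fun t _ => reflect_test_eq_integral hφ hφc a t), h0]
    simp only [mul_assoc]
    ring
  simp only [hparts]
  have hi1 : IntervalIntegrable (fun a => speedPlus p f 0 a * φ (0, reflect L (a - 0)))
      volume (-L) L :=
    (intervalIntegrable_speedPlus hpi hf 0 (-L) L).mul_continuousOn
      (hφ.continuous.comp (by fun_prop : Continuous fun a : ℝ =>
        ((0 : ℝ), reflect L (a - 0)))).continuousOn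
  have hi2 : IntervalIntegrable (fun a => ∫ t in (0 : ℝ)..T,
      2⁻¹ * (f (t, a - t) * φ (t, reflect L (a - t)))) volume (-L) L :=
    intervalIntegrable_of_abs_le (measurable_intervalIntegral
      (h := fun a t => 2⁻¹ * (f (t, a - t) * φ (t, reflect L (a - t)))) (hm4.comp measurable_swap)
      measurable_const measurable_const)
      (fun a => abs_intervalIntegral_le (fun t => hb4 t a) 0 T) _ _
  have hi1' := hi1.neg
  simp only [Pi.neg_def] at hi1'
  rw [intervalIntegral.integral_sub hi1' hi2, intervalIntegral.integral_neg]

end Neumann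

/-! ### Weak form, conservation of energy and existence -/

section Existence

variable {L M c : ℝ} {p : ℝ → ℝ} {f u : ℝ × ℝ → ℝ}

/-- One integration by parts in time turns `u φ_tt` into `-u_t φ_t` and a term at `t = 0`; the
identity along characteristics then cancels the space-time integrals. -/
lemma weakForm_of_wave (hL : 0 < L) (hpi : ∀ a b, IntervalIntegrable p volume a b)
    (hpp : Function.Periodic p (2 * L)) (hf : IsSymmSource (2 * L) M f) (hu : Continuous u)
    (hw : ∀ t, 0 ≤ t → ∀ x, u (t, x) = freeWave c p t x + duhamel f t x) {φ : ℝ × ℝ → ℝ}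
    (hφ : ContDiff ℝ ∞ φ) (hφc : HasCompactSupport φ) :
    ∫ z in strip L, (u z * dt (dt φ) z + spaceSlope p f z * dx φ z - f z * φ z) =
      (∫ x in Ioo 0 L, velocity p f (0, x) * φ (0, x)) -
        ∫ x in Ioo 0 L, u (0, x) * dt φ (0, x) := by
  have hφ1 : ContDiff ℝ 1 φ := hφ.of_le (by simp)
  have hdt : ContDiff ℝ ∞ (dt φ) := contDiff_dt hφ
  have hdt1 : ContDiff ℝ 1 (dt φ) := hdt.of_le (by simp)
  have hdtc := hasCompactSupport_dt hφc
  obtain ⟨T, hT, hTs⟩ := exists_time_bound hφc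
  have hz : ∀ z : ℝ × ℝ, T ≤ z.1 → φ z = 0 := fun z h =>
    image_eq_zero_of_notMem_tsupport (hTs z h)
  have hzt : ∀ z : ℝ × ℝ, T ≤ z.1 → dt φ z = 0 := fun z h => fderiv_apply_eq_zero (hTs z h) _
  have hztt : ∀ z : ℝ × ℝ, T ≤ z.1 → dt (dt φ) z = 0 := fun z h =>
    fderiv_apply_eq_zero (fun h' => hTs z h (tsupport_fderiv_apply_subset ℝ (1, 0) h')) _
  have hzx : ∀ z : ℝ × ℝ, T ≤ z.1 → dx φ z = 0 := fun z h => fderiv_apply_eq_zero (hTs z h) _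
  have hut := hasTimeDeriv_velocity hpi hf hu hw
  have hi1 : IntegrableOn (fun z => u z * dt (dt φ) z) (Ioc 0 T ×ˢ Ioc 0 L) :=
    integrableOn_box_of_continuous (hu.mul (continuous_dt hdt1)) T 0 L
  have hi2 : IntegrableOn (fun z => spaceSlope p f z * dx φ z) (Ioc 0 T ×ˢ Ioc 0 L) :=
    integrableOn_mul_test (integrableOn_box_slope hpi hf T 0 L) (continuous_dx hφ1)
      (hasCompactSupport_dx hφc)
  have hi3 : IntegrableOn (fun z => f z * φ z) (Ioc 0 T ×ˢ Ioc 0 L) := by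
    simpa only [mul_comm] using integrableOn_mul_of_abs_le
      (integrableOn_box_of_continuous hφ1.continuous T 0 L) hf.measurable hf.abs_le
  have hi4 : IntegrableOn (fun z => velocity p f z * dt φ z) (Ioc 0 T ×ˢ Ioc 0 L) :=
    integrableOn_mul_test (integrableOn_box_velocity hpi hf T 0 L) (continuous_dt hφ1) hdtc
  have hbox : ∀ {g : ℝ × ℝ → ℝ}, IntegrableOn g (Ioc 0 T ×ˢ Ioc 0 L) →
      ∫ z in Ioc 0 T ×ˢ Ioc 0 L, g z = ∫ t in (0 : ℝ)..T, ∫ x in (0 : ℝ)..L, g (t, x) := by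
    intro g hg
    rw [Measure.volume_eq_prod, setIntegral_prod g hg, intervalIntegral.integral_of_le hT.le]
    simp only [intervalIntegral.integral_of_le hL.le]
  have hbox' : ∀ {g : ℝ × ℝ → ℝ}, IntegrableOn g (Ioc 0 T ×ˢ Ioc 0 L) →
      ∫ z in Ioc 0 T ×ˢ Ioc 0 L, g z = ∫ x in (0 : ℝ)..L, ∫ t in (0 : ℝ)..T, g (t, x) := by
    intro g hg
    rw [hbox hg, intervalIntegral_swap (h := fun t x => g (t, x))
      (integrableOn_uIoc_prod hT.le hL.le hg)]
  have hi12 : IntegrableOn (fun z => u z * dt (dt φ) z + spaceSlope p f z * dx φ z)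
      (Ioc 0 T ×ˢ Ioc 0 L) := hi1.add hi2
  have hi123 : IntegrableOn
      (fun z => u z * dt (dt φ) z + spaceSlope p f z * dx φ z - f z * φ z)
      (Ioc 0 T ×ˢ Ioc 0 L) := hi12.sub hi3
  have hi42 : IntegrableOn (fun z => velocity p f z * dt φ z - spaceSlope p f z * dx φ z)
      (Ioc 0 T ×ˢ Ioc 0 L) := hi4.sub hi2
  have e0 : ∫ z in strip L, (u z * dt (dt φ) z + spaceSlope p f z * dx φ z - f z * φ z) =
      ∫ z in Ioc 0 T ×ˢ Ioc 0 L, (u z * dt (dt φ) z + spaceSlope p f z * dx φ z - f z * φ z) := by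
    rw [setIntegral_strip_eq hT.le hL.le hi123 fun z h => by
      rw [hz z h.le, hzx z h.le, hztt z h.le]; ring]
    exact (hbox hi123).symm
  have e1 : ∫ z in Ioc 0 T ×ˢ Ioc 0 L, (u z * dt (dt φ) z + spaceSlope p f z * dx φ z - f z * φ z) =
      (∫ z in Ioc 0 T ×ˢ Ioc 0 L, u z * dt (dt φ) z) +
        (∫ z in Ioc 0 T ×ˢ Ioc 0 L, spaceSlope p f z * dx φ z) -
        ∫ z in Ioc 0 T ×ˢ Ioc 0 L, f z * φ z := by
    rw [integral_sub hi12 hi3, integral_add hi1 hi2]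
  have e2 : ∫ z in Ioc 0 T ×ˢ Ioc 0 L, u z * dt (dt φ) z =
      -(∫ x in (0 : ℝ)..L, u (0, x) * dt φ (0, x)) -
        ∫ z in Ioc 0 T ×ˢ Ioc 0 L, velocity p f z * dt φ z := by
    rw [hbox' hi1, hbox' hi4]
    have h1 : ∀ x, ∫ t in (0 : ℝ)..T, u (t, x) * dt (dt φ) (t, x) =
        -(u (0, x) * dt φ (0, x)) - ∫ t in (0 : ℝ)..T, velocity p f (t, x) * dt φ (t, x) :=
      fun x => hut.integral_mul_dt hdt1 hT.le (hzt (T, x) le_rfl)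
    simp only [h1]
    have hc : Continuous fun x => -(u (0, x) * dt φ (0, x)) :=
      ((hu.mul (continuous_dt hφ1)).comp (by fun_prop : Continuous fun x : ℝ => ((0 : ℝ), x))).neg
    have hi5 : IntervalIntegrable (fun x => ∫ t in (0 : ℝ)..T, velocity p f (t, x) * dt φ (t, x))
        volume 0 L := by
      rw [intervalIntegrable_iff_integrableOn_Ioc_of_le hL.le]
      have h2 : Integrable (fun z => velocity p f z * dt φ z)
          ((volume.restrict (Ioc 0 T)).prod (volume.restrict (Ioc 0 L))) := by
        rw [Measure.prod_restrict]; exact hi4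
      simp only [intervalIntegral.integral_of_le hT.le]
      exact h2.integral_prod_right
    rw [intervalIntegral.integral_sub (hc.intervalIntegrable 0 L) hi5, intervalIntegral.integral_neg]
  have e3 := integral_velocity_dt_sub_slope_dx hL hpi hpp hf hφ1 hφc hT.le
    fun x => hz (T, x) le_rfl
  rw [← hbox hi42, ← hbox hi3] at e3
  have e4 : ∫ z in Ioc 0 T ×ˢ Ioc 0 L, (velocity p f z * dt φ z - spaceSlope p f z * dx φ z) =
      (∫ z in Ioc 0 T ×ˢ Ioc 0 L, velocity p f z * dt φ z) -
        ∫ z in Ioc 0 T ×ˢ Ioc 0 L, spaceSlope p f z * dx φ z := integral_sub hi4 hi2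
  rw [e4] at e3
  rw [e0, e1, e2, ← intervalIntegral_eq_integral_Ioo hL.le, ← intervalIntegral_eq_integral_Ioo hL.le]
  linarith

lemma integrableOn_kinetic (hL : 0 < L) (hpm : Measurable p)
    (hp2 : ∀ a b, IntervalIntegrable (fun y => p y ^ 2) volume a b)
    (hf : IsSymmSource (2 * L) M f) (t : ℝ) :
    IntegrableOn (fun y => (velocity p f (t, y) ^ 2 + spaceSlope p f (t, y) ^ 2) / 2) (Ioo 0 L) :=
  ((memL2_velocity hpm hp2 hf hL t).integrable_sq.add
    (memL2_slope hpm hp2 hf hL t).integrable_sq).div_const 2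

/-- Conservation of energy. -/
lemma energy_eq_of_wave {Φ : ℝ → ℝ} (hΦ : IsAdhesionPotential Φ) (hL : 0 < L) (hpm : Measurable p)
    (hp2 : ∀ a b, IntervalIntegrable (fun y => p y ^ 2) volume a b)
    (hpp : Function.Periodic p (2 * L)) (hf : IsSymmSource (2 * L) M f) (hu : Continuous u)
    (hw : ∀ t, 0 ≤ t → ∀ x, u (t, x) = freeWave c p t x + duhamel f t x)
    (hfu : ∀ z, f z = -deriv Φ (u z)) {t : ℝ} (ht : 0 ≤ t) :
    energy L Φ (fun x => velocity p f (t, x)) (fun x => spaceSlope p f (t, x)) (fun x => u (t, x)) =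
      energy L Φ (fun x => velocity p f (0, x)) (fun x => spaceSlope p f (0, x))
        (fun x => u (0, x)) := by
  obtain ⟨K, hK⟩ := hΦ.exists_lipschitzWith
  have hut := hasTimeDeriv_velocity (intervalIntegrable_of_sq hpm hp2) hf hu hw
  have hΦc : ∀ s, Continuous fun x => Φ (u (s, x)) := fun s =>
    hΦ.continuous.comp (hu.comp (by fun_prop))
  have hΦi : ∀ s, IntegrableOn (fun x => Φ (u (s, x))) (Ioo 0 L) := fun s =>
    (intervalIntegrable_iff_integrableOn_Ioo_of_le hL.le).1 ((hΦc s).intervalIntegrable 0 L)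
  have hE : ∀ s, energy L Φ (fun x => velocity p f (s, x)) (fun x => spaceSlope p f (s, x))
      (fun x => u (s, x)) =
      (∫ y in (0 : ℝ)..L, (velocity p f (s, y) ^ 2 + spaceSlope p f (s, y) ^ 2) / 2) +
        ∫ y in (0 : ℝ)..L, Φ (u (s, y)) := fun s => by
    rw [energy, integral_add (integrableOn_kinetic hL hpm hp2 hf s) (hΦi s),
      intervalIntegral_eq_integral_Ioo hL.le, intervalIntegral_eq_integral_Ioo hL.le]
  rw [hE, hE, kinetic_energy_identity hL hpm hp2 hpp hf ht]
  -- On each line `x = const` the work done by the source is exactly the loss of potential energy,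
  -- by the chain rule across the corners of `Φ`.
  have h1 : ∀ x, ∫ s in (0 : ℝ)..t, f (s, x) * velocity p f (s, x) =
      Φ (u (0, x)) - Φ (u (t, x)) := by
    intro x
    have h2 := integral_deriv_comp_mul hK (fun s h1 h2 => hΦ.differentiableAt h1 h2) ht
      (y := fun s => u (s, x)) (hut.intervalIntegrable x 0 t) fun s hs => hut.eq_integral x s hs.1
    have h3 : ∀ s, f (s, x) * velocity p f (s, x) =
        -(deriv Φ (u (s, x)) * velocity p f (s, x)) := fun s => by rw [hfu, neg_mul]
    simp only [h3, intervalIntegral.integral_neg]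
    linarith
  simp only [h1]
  rw [intervalIntegral.integral_sub ((hΦc 0).intervalIntegrable 0 L)
    ((hΦc t).intervalIntegrable 0 L)]
  ring

lemma eLpNorm_two_le_of_integral_sq_le {g : ℝ → ℝ} {R : ℝ} (hg : MemL2 L g)
    (hR : ∫ x in Ioo 0 L, g x ^ 2 ≤ R) :
    eLpNorm g 2 (volume.restrict (Ioo 0 L)) ≤ (Real.sqrt R).toNNReal := by
  rw [hg.eLpNorm_eq_integral_rpow_norm (by norm_num) (by norm_num)]
  change ENNReal.ofReal _ ≤ ENNReal.ofReal _
  refine ENNReal.ofReal_le_ofReal ?_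
  have h1 : ∀ x, ‖g x‖ ^ (2 : ENNReal).toReal = g x ^ 2 := fun x => by
    rw [ENNReal.toReal_ofNat, Real.rpow_ofNat, Real.norm_eq_abs, sq_abs]
  simp only [h1]
  rw [ENNReal.toReal_ofNat, Real.sqrt_eq_rpow, one_div]
  exact Real.rpow_le_rpow (integral_nonneg fun x => sq_nonneg _) hR (by norm_num)

/-- Since `|Φ| ≤ B`, the potential energy is at least `-B L`, so energy conservation bounds the
quadratic part by `E + B L` uniformly in time; the squared norms of `u_t` and `u_x` are each at most
twice that. -/
lemma memLinftyL2_of_wave {Φ : ℝ → ℝ} (hΦ : IsAdhesionPotential Φ) (hL : 0 < L)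
    (hpm : Measurable p) (hp2 : ∀ a b, IntervalIntegrable (fun y => p y ^ 2) volume a b)
    (hpp : Function.Periodic p (2 * L)) (hf : IsSymmSource (2 * L) M f) (hu : Continuous u)
    (hw : ∀ t, 0 ≤ t → ∀ x, u (t, x) = freeWave c p t x + duhamel f t x)
    (hfu : ∀ z, f z = -deriv Φ (u z)) :
    MemLinftyL2 L (velocity p f) ∧ MemLinftyL2 L (spaceSlope p f) := by
  obtain ⟨B, hB⟩ := hΦ.exists_abs_le
  set E := energy L Φ (fun x => velocity p f (0, x)) (fun x => spaceSlope p f (0, x))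
    (fun x => u (0, x))
  have hkin : ∀ t, 0 ≤ t →
      ∫ y in Ioo 0 L, (velocity p f (t, y) ^ 2 + spaceSlope p f (t, y) ^ 2) / 2 ≤ E + B * L := by
    intro t ht
    have hΦi : IntegrableOn (fun x => Φ (u (t, x))) (Ioo 0 L) :=
      (intervalIntegrable_iff_integrableOn_Ioo_of_le hL.le).1
        ((hΦ.continuous.comp (hu.comp (by fun_prop : Continuous fun x : ℝ =>
          (t, x)))).intervalIntegrable 0 L)
    have h1 := energy_eq_of_wave hΦ hL hpm hp2 hpp hf hu hw hfu ht
    rw [energy, integral_add (integrableOn_kinetic hL hpm hp2 hf t) hΦi] at h1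
    have h2 : |∫ x in (0 : ℝ)..L, Φ (u (t, x))| ≤ B * |L - 0| :=
      abs_intervalIntegral_le (fun x => hB _) 0 L
    rw [intervalIntegral_eq_integral_Ioo hL.le, sub_zero, abs_of_pos hL] at h2
    linarith [neg_le_of_abs_le h2]
  have hsq := fun t => (memL2_velocity hpm hp2 hf hL t).integrable_sq
  have hsq' := fun t => (memL2_slope hpm hp2 hf hL t).integrable_sq
  have hsplit : ∀ t, ∫ y in Ioo 0 L, (velocity p f (t, y) ^ 2 + spaceSlope p f (t, y) ^ 2) / 2 =
      ((∫ y in Ioo 0 L, velocity p f (t, y) ^ 2) + ∫ y in Ioo 0 L, spaceSlope p f (t, y) ^ 2) / 2 :=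
    fun t => by rw [integral_div, integral_add (hsq t) (hsq' t)]
  have hn : ∀ (g : ℝ × ℝ → ℝ) t, 0 ≤ ∫ y in Ioo 0 L, g (t, y) ^ 2 := fun g t =>
    integral_nonneg fun x => sq_nonneg _
  refine ⟨⟨(measurable_velocity hpm hf.measurable).aestronglyMeasurable,
    (Real.sqrt (2 * (E + B * L))).toNNReal, ?_⟩,
    (measurable_slope hpm hf.measurable).aestronglyMeasurable,
    (Real.sqrt (2 * (E + B * L))).toNNReal, ?_⟩
  · refine (ae_restrict_iff' measurableSet_Ioi).2 (Eventually.of_forall fun t ht => ?_)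
    refine eLpNorm_two_le_of_integral_sq_le (memL2_velocity hpm hp2 hf hL t) ?_
    have h1 := hkin t (le_of_lt ht)
    rw [hsplit] at h1
    linarith [hn (spaceSlope p f) t]
  · refine (ae_restrict_iff' measurableSet_Ioi).2 (Eventually.of_forall fun t ht => ?_)
    refine eLpNorm_two_le_of_integral_sq_le (memL2_slope hpm hp2 hf hL t) ?_
    have h1 := hkin t (le_of_lt ht)
    rw [hsplit] at h1
    linarith [hn (velocity p f) t]

end Existence

lemma exists_dissipativeSolution {L : ℝ} (hL : 0 < L) {Φ : ℝ → ℝ} (hΦ : IsAdhesionPotential Φ)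
    {u₀ u₁ : ℝ → ℝ} (hu₀ : MemH1 L u₀) (hu₁ : MemL2 L u₁) :
    ∃ u : ℝ × ℝ → ℝ, IsDissipativeSolution L Φ u₀ u₁ u := by
  obtain ⟨u₀', hH⟩ := hu₀
  obtain ⟨K, hK⟩ := hΦ.exists_lipschitzWith
  have hbound : ∀ s, |deriv Φ s| ≤ K := fun s => norm_deriv_le_of_lipschitz hK
  obtain ⟨c, hc⟩ := hH.exists_ae_eq_primitive hL
  -- Borel representatives are needed because the data are composed with the reflection.
  obtain ⟨v, hv, huv⟩ : ∃ v, Measurable v ∧ u₁ =ᵐ[volume.restrict (Ioo 0 L)] v :=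
    ⟨_, hu₁.1.aemeasurable.measurable_mk, hu₁.1.aemeasurable.ae_eq_mk⟩
  obtain ⟨w, hw, huw⟩ : ∃ w, Measurable w ∧ u₀' =ᵐ[volume.restrict (Ioo 0 L)] w :=
    ⟨_, hH.2.1.1.aemeasurable.measurable_mk, hH.2.1.1.aemeasurable.ae_eq_mk⟩
  set p := initialSpeed L v w
  have hpm : Measurable p := measurable_initialSpeed hv hw
  have hp2 : ∀ a b, IntervalIntegrable (fun y => p y ^ 2) volume a b :=
    intervalIntegrable_initialSpeed_sq hL (MemLp.ae_eq huv hu₁) (MemLp.ae_eq huw hH.2.1)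
  have hpi := intervalIntegrable_of_sq hpm hp2
  have hpp : Function.Periodic p (2 * L) := initialSpeed_periodic L v w
  obtain ⟨u, hu, hue, hup, hwave⟩ := exists_mild_solution (c := c) (measurable_deriv Φ) hbound
    (fun s h1 h2 => hΦ.continuousAt_deriv h1 h2) hΦ.deriv_one hΦ.deriv_neg_one hpm hpi hpp
  set f : ℝ × ℝ → ℝ := fun z => -deriv Φ (u z)
  have hf : IsSymmSource (2 * L) K f := by
    refine ⟨((measurable_deriv Φ).comp hu.measurable).neg, fun z => ?_, fun s y => ?_, fun s y => ?_⟩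
    · rw [abs_neg]; exact hbound _
    · simp only [f, hue]
    · simp only [f, hup]
  have hut := hasTimeDeriv_velocity hpi hf hu hwave
  have hux := hasSpaceDeriv_slope hpi hf hu hwave
  have hmem := memLinftyL2_of_wave hΦ hL hpm hp2 hpp hf hu hwave fun _ => rfl
  have hvel0 : u₁ =ᵐ[volume.restrict (Ioo 0 L)] fun x => velocity p f (0, x) := by
    filter_upwards [huv, ae_restrict_mem measurableSet_Ioo] with x hx hxL
    have h1 := initialSpeed_of_mem hL v w hxL
    have h2 := initialSpeed_neg_of_mem hL v w hxL
    simp only [velocity, speedPlus_zero, zero_add, zero_sub]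
    linarith
  have hslope0 : u₀' =ᵐ[volume.restrict (Ioo 0 L)] fun x => spaceSlope p f (0, x) := by
    filter_upwards [huw, ae_restrict_mem measurableSet_Ioo] with x hx hxL
    have h1 := initialSpeed_of_mem hL v w hxL
    have h2 := initialSpeed_neg_of_mem hL v w hxL
    simp only [spaceSlope, speedPlus_zero, zero_add, zero_sub]
    linarith
  -- `u₀` agrees almost everywhere with `c` plus the primitive of `u₀'`; this `c` was used as the
  -- constant in `freeWave`.
  have hval0 : u₀ =ᵐ[volume.restrict (Ioo 0 L)] fun x => u (0, x) := by
    filter_upwards [ae_restrict_of_ae hc, ae_restrict_mem measurableSet_Ioo] with x hx hxL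
    rw [hx hxL, hux.eq_integral 0 x le_rfl, hwave 0 le_rfl, duhamel_zero]
    have h1 : ∫ y in (0 : ℝ)..x, u₀' y = ∫ y in (0 : ℝ)..x, spaceSlope p f (0, y) := by
      rw [intervalIntegral_eq_integral_Ioo hxL.1.le, intervalIntegral_eq_integral_Ioo hxL.1.le]
      exact integral_congr_ae (ae_restrict_of_ae_restrict_of_subset
        (Ioo_subset_Ioo_right hxL.2.le) hslope0)
    rw [h1]
    simp [freeWave]
  have hE0 : energy L Φ u₁ u₀' u₀ = energy L Φ (fun x => velocity p f (0, x))
      (fun x => spaceSlope p f (0, x)) (fun x => u (0, x)) := by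
    refine integral_congr_ae ?_
    filter_upwards [hvel0, hslope0, hval0] with x h1 h2 h3
    rw [h1, h2, h3]
  refine ⟨u, hu.continuousOn, velocity p f, spaceSlope p f, u₀', hut.isWeakDerivOn hL,
    hux.isWeakDerivOn hL, hH, hmem.1, hmem.2, fun φ hφ hφc => ?_, ?_⟩
  · have h1 := weakForm_of_wave hL hpi hpp hf hu hwave hφ hφc
    have h2 : ∫ x in Ioo 0 L, u₁ x * φ (0, x) =
        ∫ x in Ioo 0 L, velocity p f (0, x) * φ (0, x) := by
      refine integral_congr_ae ?_
      filter_upwards [hvel0] with x hx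
      rw [hx]
    have h3 : ∫ x in Ioo 0 L, u₀ x * dt φ (0, x) = ∫ x in Ioo 0 L, u (0, x) * dt φ (0, x) := by
      refine integral_congr_ae ?_
      filter_upwards [hval0] with x hx
      rw [hx]
    have h4 : ∫ z in strip L, (u z * dt (dt φ) z + spaceSlope p f z * dx φ z + deriv Φ (u z) * φ z) =
        ∫ z in strip L, (u z * dt (dt φ) z + spaceSlope p f z * dx φ z - f z * φ z) := by
      congr 1
      funext z
      simp only [f]
      ring
    rw [h4, h1, h2, h3]
    ring
  · refine (ae_restrict_iff' measurableSet_Ioi).2 (Eventually.of_forall fun t ht => ?_)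
    rw [hE0]
    exact (energy_eq_of_wave hΦ hL hpm hp2 hpp hf hu hwave (fun _ => rfl) (le_of_lt ht)).le

end AdhesiveString

theorem theorem3p1 (L : ℝ) (hL : 0 < L) (Φ : ℝ → ℝ)
    (hΦ : AdhesiveString.IsAdhesionPotential Φ) (u₀ u₁ : ℝ → ℝ)
    (hu₀ : AdhesiveString.MemH1 L u₀) (hu₁ : AdhesiveString.MemL2 L u₁) :
    ∃ u : ℝ × ℝ → ℝ, AdhesiveString.IsDissipativeSolution L Φ u₀ u₁ u :=
  AdhesiveString.exists_dissipativeSolution hL hΦ hu₀ hu₁
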